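/- Let $G=(V,E)$ be a finite connected simple graph with edge costs $c_e\ge 0$, and let $T\subseteq V$ with $|T|$ even and $|T|\ge 4$. For $S\subseteq V$ let $E(S)$ be the set of edges with both ends in $S$ and $\delta(S)$ the set of edges with exactly one end in $S$. Consider the linear program (L.P.1) minimize $c(x)=\sum_{e\in E}c_ex_e$ subject to - $x(E(S))\le |S|-1$ for all $S\subsetneq V$ with $|S|\ge 2$, - $x(E(V))=|V|-1$, - $x(\delta(S))\ge 2$ for all $\emptyset\ne S\subsetneq V$ with $|S\cap T|$ even, - $x_e\ge 0$ for all $e\in E$. For $D\subseteq V$, a $D$-join is a finite multiset of edges of $G$ in which the nodes of odd degree are exactly those of $D$; it is a connected $D$-join if moreover it forms a connected spanning subgraph on $V$. Costs of multisets count multiplicities. The algorithm is the following: (1) take an optimal solution $x^*$ of (L.P.1); (2) write $x^*=\sum_{i=1}^k\lambda_i\chi(J_i)$ with spanning trees $J_1,\dots,J_k$ of $G$ (identified with their edge sets), where $\chi(J_i)\in\{0,1\}^E$ is the incidence vector of $J_i$, $\lambda_i\ge 0$ and $\sum_i\lambda_i=1$; (3) for each $i$ let $D_i$ be the set of nodes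 of $T$ with even degree in $J_i$ together with the nodes of $V\setminus T$ with odd degree in $J_i$, let $M_i$ be a minimum-cost $D_i$-join, and let $F_i$ be the multiset union (with multiplicities added) of $J_i$ and $M_i$. The deterministic algorithm outputs a cheapest $F_i$; the randomized algorithm outputs $F_i$ with probability $\lambda_i$. Theorem. (a) (L.P.1) is feasible if $G$ is complete, in particular if $G$ is a metric graph (complete, with costs satisfying the triangle inequality); and it has an optimal solution whenever it is feasible. (b) Each further step can be carried out: every optimal $x^*$ has a decomposition as in (2) with $k\le|E|+1$, and for every spanning tree $J$ of $G$ a minimum-cost $D$-join exists for its set $D$ of nodes of wrong degree (the nodes of $T$ with even degree in $J$ and the nodes of $V\setminus T$ with odd degree in $J$). (c) For all choices of $x^*$, the decomposition and the $M_i$, every $F_i$ is a connected $T$-join, and the expected cost of the output of the randomized algorithm satisfies $\sum_i\lambda_i\,c(F_i)\le\frac{13}{8}\,c(x^*)$. (d) Whenever (L.P.1) is feasible, the deterministic algorithm has an output; and every output, for all choices made, is a connected $T$-join of cost at most $\frac{13}{8}$ times the optimal value of (L.P.1). -/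

import Mathlib

namespace ConnectedTJoin

variable {V : Type*} [Fintype V] [DecidableEq V]

/-- `E(S)`: the edges of `G` with both endpoints in `S`. -/
def edgesInside (G : SimpleGraph V) [DecidableRel G.Adj] (S : Finset V) : Finset (Sym2 V) :=
  G.edgeFinset.filter fun e => e ∈ S.sym2

/-- `δ(S)`: the edges of `G` with exactly one endpoint in `S`. -/
def cut (G : SimpleGraph V) [DecidableRel G.Adj] (S : Finset V) : Finset (Sym2 V) :=
  G.edgeFinset.filter fun e => ∃ u ∈ S, ∃ v ∈ Sᶜ, e = s(u, v)

/-- `x` satisfies the constraints of the linear program (L.P.1) of `(G, T)`. Only the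
values of `x` on the edges of `G` matter. -/
structure IsFeasible (G : SimpleGraph V) [DecidableRel G.Adj] (T : Finset V)
    (x : Sym2 V → ℝ) : Prop where
  subtour : ∀ S : Finset V, S ≠ Finset.univ → 2 ≤ S.card →
    ∑ e ∈ edgesInside G S, x e ≤ (S.card : ℝ) - 1
  total : ∑ e ∈ edgesInside G Finset.univ, x e = (Fintype.card V : ℝ) - 1
  even_cut : ∀ S : Finset V, S.Nonempty → S ≠ Finset.univ → Even (S ∩ T).card →
    2 ≤ ∑ e ∈ cut G S, x e
  nonneg : ∀ e ∈ G.edgeFinset, 0 ≤ x e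

/-- The objective function `∑_{e ∈ E} c_e x_e` of (L.P.1). -/
def lpCost (G : SimpleGraph V) [DecidableRel G.Adj] (c x : Sym2 V → ℝ) : ℝ :=
  ∑ e ∈ G.edgeFinset, c e * x e

/-- `x` is an optimal solution of (L.P.1). -/
def IsOptimal (G : SimpleGraph V) [DecidableRel G.Adj] (c : Sym2 V → ℝ) (T : Finset V)
    (x : Sym2 V → ℝ) : Prop :=
  IsFeasible G T x ∧ ∀ x' : Sym2 V → ℝ, IsFeasible G T x' → lpCost G c x ≤ lpCost G c x'

/-- The cost of a multiset of edges, counted with multiplicity. -/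
def cost (c : Sym2 V → ℝ) (F : Multiset (Sym2 V)) : ℝ :=
  (F.map c).sum

/-- The degree of `v` in the multigraph `(V, F)`, for a multiset `F` of edges without loops. -/
def deg (F : Multiset (Sym2 V)) (v : V) : ℕ :=
  F.countP fun e => v ∈ e

/-- `F` is a `T`-join of `G`: a multiset of edges of `G` whose odd-degree nodes are
exactly those of `T`. -/
def IsJoin (G : SimpleGraph V) (T : Finset V) (F : Multiset (Sym2 V)) : Prop :=
  (∀ e ∈ F, e ∈ G.edgeSet) ∧ ∀ v, Odd (deg F v) ↔ v ∈ T

/-- `F` is a (spanning) connected `T`-join of `G`. -/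
def IsConnectedJoin (G : SimpleGraph V) (T : Finset V) (F : Multiset (Sym2 V)) : Prop :=
  IsJoin G T F ∧ (SimpleGraph.fromEdgeSet {e | e ∈ F}).Connected

/-- `M` is a `D`-join of `G` of minimum cost. -/
def IsMinCostJoin (G : SimpleGraph V) (c : Sym2 V → ℝ) (D : Finset V)
    (M : Multiset (Sym2 V)) : Prop :=
  IsJoin G D M ∧ ∀ M' : Multiset (Sym2 V), IsJoin G D M' → cost c M ≤ cost c M'

/-- `J` is the edge set of a spanning tree of `G`. -/
def IsSpanningTree (G : SimpleGraph V) (J : Finset (Sym2 V)) : Prop :=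
  (∀ e ∈ J, e ∈ G.edgeSet) ∧ (SimpleGraph.fromEdgeSet (J : Set (Sym2 V))).IsTree

/-- The nodes of wrong degree in `J`: those of `T` with even degree and those outside `T`
with odd degree. -/
def wrongDegree (T : Finset V) (J : Finset (Sym2 V)) : Finset V :=
  Finset.univ.filter fun v =>
    (v ∈ T ∧ Even (deg J.val v)) ∨ (v ∉ T ∧ Odd (deg J.val v))

/-- `x = ∑ i, lam i • χ(J i)` on the edges of `G`, as a convex combination of incidence
vectors of spanning trees of `G`. -/
structure IsTreeDecomposition (G : SimpleGraph V) (x : Sym2 V → ℝ) {k : ℕ}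
    (J : Fin k → Finset (Sym2 V)) (lam : Fin k → ℝ) : Prop where
  spanning : ∀ i, IsSpanningTree G (J i)
  nonneg : ∀ i, 0 ≤ lam i
  sum_eq_one : ∑ i, lam i = 1
  combination : ∀ e ∈ G.edgeSet, x e = ∑ i, lam i * (if e ∈ J i then 1 else 0)

/-- The choices made in one run of the algorithm: an optimal solution `x` of (L.P.1), a
decomposition of `x` into spanning trees `J i` with weights `lam i`, and for each tree a
minimum-cost join `M i` of its nodes of wrong degree. -/
structure IsRun (G : SimpleGraph V) [DecidableRel G.Adj] (c : Sym2 V → ℝ) (T : Finset V)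
    (x : Sym2 V → ℝ) {k : ℕ} (J : Fin k → Finset (Sym2 V)) (lam : Fin k → ℝ)
    (M : Fin k → Multiset (Sym2 V)) : Prop where
  optimal : IsOptimal G c T x
  decomposition : IsTreeDecomposition G x J lam
  joins : ∀ i, IsMinCostJoin G c (wrongDegree T (J i)) (M i)

/-- The multiset union of `J` and `M` (an edge in both is taken twice). -/
def solution (J : Finset (Sym2 V)) (M : Multiset (Sym2 V)) : Multiset (Sym2 V) :=
  J.val + M

/-- `F` is an output of the deterministic algorithm: a cheapest one of the
solutions `J i + M i` of some run. -/
def IsOutput (G : SimpleGraph V) [DecidableRel G.Adj] (c : Sym2 V → ℝ) (T : Finset V)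
    (F : Multiset (Sym2 V)) : Prop :=
  ∃ (x : Sym2 V → ℝ) (k : ℕ) (J : Fin k → Finset (Sym2 V)) (lam : Fin k → ℝ)
    (M : Fin k → Multiset (Sym2 V)), IsRun G c T x J lam M ∧
    ∃ i, F = solution (J i) (M i) ∧
      ∀ j, cost c (solution (J i) (M i)) ≤ cost c (solution (J j) (M j))

end ConnectedTJoin

/-! The trees average to `x`, so the expected cost of `J i` is `c(x)` and it remains to bound the
expected cost of `M i` by `5/8 * c(x)`. By the Edmonds–Johnson inequality (`exists_chain_wt_le`), `M
i` costs at most as much as any nonnegative vector with value at least 1 on every cut that is odd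
for the wrong-degree nodes of `J i`. The vector used is `joinVector`: one fifth of the tree, two
fifths of `x`, and corrections. A wrong-odd cut that is `T`-even receives at least `1/5 + 2/5 * 2 =
1`. One that is `T`-odd contains an even number, hence at least two, of the tree edges, so it lacks
something only if its value `t` under `x` is below `3/2`. Such narrow cuts receive the missing `2/5
* (3/2 - t)` times a vector `f U` of total 1 on the cut.

The corrections are cheap for two reasons. Narrow sets avoiding a fixed node are laminar
(`IsFeasible.laminar`), and none is a disjoint union of smaller ones
(`IsTreeDecomposition.biUnion_ne`); by Hall's theorem their cuts have distinct representatives in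
every tree (`IsTreeDecomposition.exists_representatives`). With `f U` the average of the
representatives of `U`, all `f U` together cost at most `c(x)`. Moreover `U` is corrected only if
the tree meets its cut evenly, which has probability at most `t - 1`. As `2/5 * (t - 1) * (3/2 - t)
≤ 1/40`, the total is `1/5 + 2/5 + 1/40 = 5/8`.

The Edmonds–Johnson inequality follows from a tight odd cut (`exists_tight_cut`) and a compactness
argument; Edmonds' tree decomposition follows from separation, because a minimum-weight tree is no
heavier than a feasible vector. Parities are handled by mod 2 chains of edges. -/

namespace ConnectedTJoin

set_option linter.unusedSectionVars false
set_option linter.unusedDecidableInType false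
set_option linter.unusedFintypeInType false

variable {V : Type*} [Fintype V] [DecidableEq V]

/-! ### Cuts and mod 2 chains -/

/-- The sum over `v ∈ S` of the terms of the ends of `s(a, b)`. -/
lemma sum_mem_pair {R : Type*} [AddCommMonoid R] (S : Finset V) {a b : V} (hab : a ≠ b) (x : R) :
    ∑ v ∈ S, (if v ∈ s(a, b) then x else 0) =
      (if a ∈ S then x else 0) + (if b ∈ S then x else 0) := by
  have : ∀ v, (if v ∈ s(a, b) then x else 0) =
      (if v = a then x else 0) + (if v = b then x else 0) := by
    intro v
    by_cases h1 : v = a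
    · subst h1; simp [hab]
    · simp [h1]
  simp only [this, Finset.sum_add_distrib, Finset.sum_ite_eq']

lemma mk_mem_cut {G : SimpleGraph V} [DecidableRel G.Adj] {S : Finset V} {a b : V} :
    s(a, b) ∈ cut G S ↔ G.Adj a b ∧ (a ∈ S ∧ b ∉ S ∨ a ∉ S ∧ b ∈ S) := by
  simp only [cut, Finset.mem_filter, SimpleGraph.mem_edgeFinset, SimpleGraph.mem_edgeSet,
    Finset.mem_compl, Sym2.eq_iff]
  refine and_congr_right fun _ => ⟨?_, ?_⟩
  · rintro ⟨u, hu, v, hv, ⟨rfl, rfl⟩ | ⟨rfl, rfl⟩⟩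
    · exact Or.inl ⟨hu, hv⟩
    · exact Or.inr ⟨hv, hu⟩
  · rintro (⟨h1, h2⟩ | ⟨h1, h2⟩)
    · exact ⟨a, h1, b, h2, Or.inl ⟨rfl, rfl⟩⟩
    · exact ⟨b, h2, a, h1, Or.inr ⟨rfl, rfl⟩⟩

lemma mk_mem_edgesInside {G : SimpleGraph V} [DecidableRel G.Adj] {S : Finset V} {a b : V} :
    s(a, b) ∈ edgesInside G S ↔ G.Adj a b ∧ a ∈ S ∧ b ∈ S := by
  simp [edgesInside]

lemma cut_subset {G : SimpleGraph V} [DecidableRel G.Adj] {S : Finset V} :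
    cut G S ⊆ G.edgeFinset := Finset.filter_subset _ _

lemma cut_compl {G : SimpleGraph V} [DecidableRel G.Adj] (S : Finset V) :
    cut G Sᶜ = cut G S := by
  ext e
  induction e with | _ a b
  simp only [mk_mem_cut, Finset.mem_compl]
  tauto

lemma demand_add_self {ι : Type*} (d : ι → ZMod 2) : d + d = 0 := by
  ext i; exact CharTwo.add_self_eq_zero _

/-- The boundary of a mod 2 chain of edges. -/
def bdry (f : Sym2 V → ZMod 2) (v : V) : ZMod 2 := ∑ e, if v ∈ e then f e else 0

/-- The chain `f` uses only edges of `G`. -/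
def SuppOn (G : SimpleGraph V) (f : Sym2 V → ZMod 2) : Prop := ∀ e, e ∉ G.edgeSet → f e = 0

/-- The cost of the support of a chain. -/
noncomputable def wt (c : Sym2 V → ℝ) (f : Sym2 V → ZMod 2) : ℝ :=
  ∑ e, if f e = 0 then 0 else c e

lemma bdry_add (f g : Sym2 V → ZMod 2) : bdry (f + g) = bdry f + bdry g := by
  ext v
  simp only [bdry, Pi.add_apply, ← Finset.sum_add_distrib]
  exact Finset.sum_congr rfl fun e _ => by split_ifs <;> simp

lemma bdry_zero : bdry (0 : Sym2 V → ZMod 2) = 0 := by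
  ext v; simp [bdry]

lemma bdry_single {a b : V} (hab : a ≠ b) :
    bdry (Pi.single s(a, b) 1 : Sym2 V → ZMod 2) = Pi.single a 1 + Pi.single b 1 := by
  ext v
  simp only [bdry, Pi.single_apply, Pi.add_apply, ← ite_and]
  rw [Finset.sum_eq_single s(a, b)]
  · by_cases h1 : v = a
    · subst h1; simp [hab]
    · simp [h1]
  · intro e _ he; simp [he]
  · simp

lemma SuppOn.add {G : SimpleGraph V} {f g : Sym2 V → ZMod 2} (hf : SuppOn G f) (hg : SuppOn G g) :
    SuppOn G (f + g) := fun e he => by simp [hf e he, hg e he]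

lemma SuppOn.single {G : SimpleGraph V} {e : Sym2 V} (he : e ∈ G.edgeSet) :
    SuppOn G (Pi.single e 1) := fun e' he' => by
  rw [Pi.single_apply, if_neg]; rintro rfl; exact he' he

lemma SuppOn.zero {G : SimpleGraph V} : SuppOn G (0 : Sym2 V → ZMod 2) := fun _ _ => rfl

/-- An edge with both ends in `S` is counted twice and cancels mod 2; only cut edges survive. -/
lemma sum_bdry {G : SimpleGraph V} [DecidableRel G.Adj] {f : Sym2 V → ZMod 2} (hf : SuppOn G f)
    (S : Finset V) : ∑ v ∈ S, bdry f v = ∑ e ∈ cut G S, f e := by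
  have hcut : ∑ e ∈ cut G S, f e = ∑ e, if e ∈ cut G S then f e else 0 := by
    rw [Finset.sum_ite_mem, Finset.univ_inter]
  unfold bdry
  rw [hcut, Finset.sum_comm]
  refine Finset.sum_congr rfl fun e _ => ?_
  by_cases he : e ∈ G.edgeSet
  · induction e with | _ a b
    have hab : G.Adj a b := he
    rw [sum_mem_pair S hab.ne]
    simp only [mk_mem_cut, hab, true_and]
    by_cases ha : a ∈ S <;> by_cases hb : b ∈ S <;> simp [ha, hb, CharTwo.add_self_eq_zero]
  · simp [hf e he]

lemma wt_add_le {G : SimpleGraph V} {c : Sym2 V → ℝ} (hc : ∀ e ∈ G.edgeSet, 0 ≤ c e)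
    {f g : Sym2 V → ZMod 2} (hf : SuppOn G f) (hg : SuppOn G g) :
    wt c (f + g) ≤ wt c f + wt c g := by
  unfold wt
  rw [← Finset.sum_add_distrib]
  refine Finset.sum_le_sum fun e _ => ?_
  by_cases he : e ∈ G.edgeSet
  · have := hc e he
    simp only [Pi.add_apply]
    split_ifs with h1 h2 h3 <;> simp_all
  · simp [hf e he, hg e he]

lemma zmod_two_eq_one {a : ZMod 2} (h : a ≠ 0) : a = 1 := by
  revert a; decide

lemma wt_add_single (c : Sym2 V → ℝ) {f : Sym2 V → ZMod 2} {e : Sym2 V} (he : f e ≠ 0) :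
    wt c (f + Pi.single e 1) = wt c f - c e := by
  have h1 := zmod_two_eq_one he
  have h : ∀ e', (if (f + Pi.single e 1 : Sym2 V → ZMod 2) e' = 0 then 0 else c e') =
      (if f e' = 0 then 0 else c e') - (if e' = e then c e else 0) := by
    intro e'
    by_cases h : e' = e
    · subst h
      have : (1 + 1 : ZMod 2) = 0 := rfl
      simp [h1, this]
    · simp [h]
  unfold wt
  simp_rw [h]
  rw [Finset.sum_sub_distrib, Finset.sum_ite_eq' Finset.univ e]
  simp

/-- Exchanging two chains along a common part of their sum preserves the total cost. -/
lemma wt_exchange (c : Sym2 V → ℝ) {f g p : Sym2 V → ZMod 2}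
    (hp : ∀ e, p e ≠ 0 → (f + g) e ≠ 0) : wt c (f + p) + wt c (g + p) = wt c f + wt c g := by
  unfold wt
  rw [← Finset.sum_add_distrib, ← Finset.sum_add_distrib]
  refine Finset.sum_congr rfl fun e _ => ?_
  have h := hp e
  simp only [Pi.add_apply] at h ⊢
  -- Where `p` is nonzero, exactly one of `f` and `g` is, and adding `p` hands the edge over to the
  -- other.
  have key : ∀ x y z : ZMod 2, (z ≠ 0 → x + y ≠ 0) →
      (z = 0) ∨ (z = 1 ∧ x = 0 ∧ y = 1) ∨ (z = 1 ∧ x = 1 ∧ y = 0) := by decide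
  have h11 : (1 + 1 : ZMod 2) = 0 := rfl
  rcases key _ _ _ h with h1 | ⟨h1, h2, h3⟩ | ⟨h1, h2, h3⟩ <;> simp [*]

/-- Joined vertices are the boundary of a chain. -/
lemma exists_chain_of_reachable {H : SimpleGraph V} {u v : V} (h : H.Reachable u v) :
    ∃ f : Sym2 V → ZMod 2, SuppOn H f ∧ bdry f = Pi.single u 1 + Pi.single v 1 := by
  obtain ⟨p⟩ := h
  induction p with
  | nil => exact ⟨0, SuppOn.zero, by rw [bdry_zero, demand_add_self]⟩
  | @cons a b w hab p ih =>
    obtain ⟨f, hf, hb⟩ := ih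
    refine ⟨Pi.single s(a, b) 1 + f, (SuppOn.single hab).add hf, ?_⟩
    rw [bdry_add, bdry_single hab.ne, hb]
    calc _ = Pi.single a 1 + (Pi.single b 1 + Pi.single b 1) + Pi.single w (1 : ZMod 2) := by abel
      _ = _ := by rw [demand_add_self, add_zero]

lemma bdry_sum {ι : Type*} (s : Finset ι) (f : ι → Sym2 V → ZMod 2) :
    bdry (∑ i ∈ s, f i) = ∑ i ∈ s, bdry (f i) := by
  classical
  induction s using Finset.induction_on with
  | empty => simp [bdry_zero]
  | insert a s ha ih => rw [Finset.sum_insert ha, Finset.sum_insert ha, bdry_add, ih]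

/-- In a connected graph every even demand is the boundary of a chain. -/
lemma exists_chain_of_connected {G : SimpleGraph V} (hG : G.Connected) {d : V → ZMod 2}
    (hd : ∑ v, d v = 0) : ∃ f : Sym2 V → ZMod 2, SuppOn G f ∧ bdry f = d := by
  obtain ⟨r⟩ := hG.nonempty
  choose f hf hb using fun v => exists_chain_of_reachable (hG.preconnected v r)
  have hsmul : ∀ (a : ZMod 2) (g : Sym2 V → ZMod 2), bdry (a • g) = a • bdry g := by
    intro a g; ext v; simp [bdry, Finset.mul_sum]
  -- Paths to the root `r` from all nodes of `d`; their contributions at `r` add up to `∑ v, d v =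
  -- 0`.
  refine ⟨∑ v, d v • f v, fun e he => ?_, ?_⟩
  · simp [Finset.sum_apply, fun v => hf v e he]
  · rw [bdry_sum]
    simp_rw [hsmul, hb, smul_add]
    rw [Finset.sum_add_distrib, ← Finset.sum_smul, hd, zero_smul, add_zero]
    ext w
    simp [Finset.sum_apply, Pi.single_apply]

/-! ### Tight odd cuts -/

/-- The part of a walk after its last visit of `S`, as a chain. -/
lemma walk_last_exit {H : SimpleGraph V} {S : Finset V} {a x : V} (p : H.Walk a x) (hx : x ∉ S) :
    (a ∉ S ∧ ∃ g : Sym2 V → ZMod 2, SuppOn H g ∧ bdry g = Pi.single a 1 + Pi.single x 1 ∧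
      ∀ e, g e ≠ 0 → ∀ v ∈ e, v ∉ S) ∨
    ∃ u ∈ S, ∃ w, w ∉ S ∧ H.Adj u w ∧ ∃ g : Sym2 V → ZMod 2, SuppOn H g ∧
      bdry g = Pi.single w 1 + Pi.single x 1 ∧ ∀ e, g e ≠ 0 → ∀ v ∈ e, v ∉ S := by
  induction p with
  | nil => exact Or.inl ⟨hx, 0, SuppOn.zero, by rw [bdry_zero, demand_add_self], by simp⟩
  | @cons a b x hab p ih =>
    rcases ih hx with ⟨hb, g, hg, hbd, hav⟩ | h
    · by_cases ha : a ∈ S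
      · exact Or.inr ⟨a, ha, b, hb, hab, g, hg, hbd, hav⟩
      · refine Or.inl ⟨ha, Pi.single s(a, b) 1 + g, (SuppOn.single hab).add hg, ?_, ?_⟩
        · rw [bdry_add, bdry_single hab.ne, hbd]
          calc _ = Pi.single a 1 + (Pi.single b 1 + Pi.single b 1) + Pi.single x (1 : ZMod 2) := by
                abel
            _ = _ := by rw [demand_add_self, add_zero]
        · intro e he
          by_cases h : e = s(a, b)
          · subst h
            intro v hv
            rcases Sym2.mem_iff.1 hv with rfl | rfl <;> assumption
          · exact hav e (by simpa [h] using he)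
    · exact Or.inr h

/-- A chain with boundary `{x, b}` contains a path from `x` that ends on its first visit of a
set `S ∋ b`. -/
lemma exists_subpath {G : SimpleGraph V} [DecidableRel G.Adj] {K : Sym2 V → ZMod 2}
    (hK : SuppOn G K) {x b : V} (hb : bdry K = Pi.single x 1 + Pi.single b 1) {S : Finset V}
    (hbS : b ∈ S) (hxS : x ∉ S) :
    ∃ u ∈ S, ∃ p : Sym2 V → ZMod 2, (∀ e, p e ≠ 0 → K e ≠ 0) ∧
      bdry p = Pi.single u 1 + Pi.single x 1 ∧ ((cut G S).filter (p · ≠ 0)).card ≤ 1 := by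
  classical
  set H : SimpleGraph V := SimpleGraph.fromEdgeSet {e | K e ≠ 0} with hH
  have hHK : ∀ e ∈ H.edgeSet, K e ≠ 0 := fun e he => by
    rw [hH, SimpleGraph.edgeSet_fromEdgeSet] at he; exact he.1
  -- Otherwise the component of `b` in the support of `K` has no edge of `K` in its cut, yet
  -- contains just one of the two boundary nodes.
  have hreach : H.Reachable b x := by
    by_contra hn
    have h := sum_bdry hK (Finset.univ.filter fun v => H.Reachable b v)
    rw [Finset.sum_eq_zero (s := cut G _), hb] at h
    · simp only [Pi.add_apply, Finset.sum_add_distrib, Pi.single_apply, Finset.sum_ite_eq',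
        Finset.mem_filter, Finset.mem_univ, true_and, hn, if_false, SimpleGraph.Reachable.refl,
        if_true] at h
      exact absurd h (by decide)
    · intro e he
      induction e with | _ p q
      by_contra hKe
      obtain ⟨hpq, h⟩ := mk_mem_cut.1 he
      have hadj : H.Adj p q := by
        rw [hH, SimpleGraph.fromEdgeSet_adj]; exact ⟨hKe, hpq.ne⟩
      simp only [Finset.mem_filter, Finset.mem_univ, true_and] at h
      rcases h with ⟨h1, h2⟩ | ⟨h1, h2⟩
      · exact h2 (h1.trans hadj.reachable)
      · exact h1 (h2.trans hadj.symm.reachable)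
  obtain ⟨w⟩ := hreach
  -- The walk runs from `b` to `x`; after its last exit from `S`, through `s(u, w)`, no edge touches
  -- `S`, so `s(u, w)` is the only cut edge.
  rcases walk_last_exit w hxS with ⟨h, _⟩ | ⟨u, hu, w, hw, huw, g, hg, hbd, hav⟩
  · exact absurd hbS h
  · have hs : SuppOn H (Pi.single s(u, w) 1 + g) := (SuppOn.single huw).add hg
    refine ⟨u, hu, Pi.single s(u, w) 1 + g, fun e he => ?_, ?_, ?_⟩
    · by_contra hKe
      exact he (hs e fun h => hHK e h hKe)
    · rw [bdry_add, bdry_single huw.ne, hbd]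
      calc _ = Pi.single u 1 + (Pi.single w 1 + Pi.single w 1) + Pi.single x (1 : ZMod 2) := by
            abel
        _ = _ := by rw [demand_add_self, add_zero]
    · refine (Finset.card_le_card (t := {s(u, w)}) fun e he => ?_).trans (by simp)
      rw [Finset.mem_filter] at he
      obtain ⟨hec, he⟩ := he
      rw [Finset.mem_singleton]
      by_contra hne
      have hge : g e ≠ 0 := by simpa [hne] using he
      induction e with | _ p q
      rcases (mk_mem_cut.1 hec).2 with ⟨h1, _⟩ | ⟨_, h1⟩
      · exact hav _ hge p (Sym2.mem_mk_left _ _) h1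
      · exact hav _ hge q (Sym2.mem_mk_right _ _) h1

/-- If the minimum cost of a chain with boundary `d` is positive, then some `d`-odd cut with
positive costs is met at most once by every minimum chain. -/
lemma exists_tight_cut {G : SimpleGraph V} [DecidableRel G.Adj] {c : Sym2 V → ℝ}
    (hc : ∀ e ∈ G.edgeSet, 0 ≤ c e) {d : V → ZMod 2} {F₀ : Sym2 V → ZMod 2} (hF₀ : SuppOn G F₀)
    (hbF₀ : bdry F₀ = d)
    (hmin : ∀ g, SuppOn G g → bdry g = d → wt c F₀ ≤ wt c g) (hpos : 0 < wt c F₀) :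
    ∃ S : Finset V, ∑ v ∈ S, d v = 1 ∧ (∀ e ∈ cut G S, 0 < c e) ∧
      ∀ F, SuppOn G F → bdry F = d → wt c F ≤ wt c F₀ →
        ((cut G S).filter (F · ≠ 0)).card ≤ 1 := by
  classical
  obtain ⟨e₀, he₀, hce₀⟩ : ∃ e, F₀ e ≠ 0 ∧ 0 < c e := by
    by_contra! h
    refine hpos.not_ge (Finset.sum_nonpos fun e _ => ?_)
    split_ifs with he
    · rfl
    · exact h e he
  have he₀G : e₀ ∈ G.edgeSet := by
    by_contra h; exact he₀ (hF₀ _ h)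
  induction e₀ with | _ x w₀
  have hxw : x ≠ w₀ := he₀G.ne
  -- a cheapest chain among those whose boundary differs from `d` in `x` and one more vertex
  obtain ⟨f, hf, hfmin⟩ := Set.exists_min_image
    {f : Sym2 V → ZMod 2 | SuppOn G f ∧ ∃ v, bdry f = d + Pi.single x 1 + Pi.single v 1} (wt c)
    (Set.toFinite _) ⟨F₀, hF₀, x, by rw [hbF₀, add_assoc, demand_add_self, add_zero]⟩
  obtain ⟨hfG, b, hfb⟩ := hf
  -- Deleting the positive-cost edge `s(x, w₀)` from `F₀` gives a competitor of `f`.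
  have hlt : wt c f < wt c F₀ := by
    have := hfmin (F₀ + Pi.single s(x, w₀) 1)
      ⟨hF₀.add (SuppOn.single he₀G), w₀, by rw [bdry_add, hbF₀, bdry_single hxw, add_assoc]⟩
    rw [wt_add_single c he₀] at this
    linarith
  -- Along zero-cost edges the end `b` of `f` can be moved for free; `S` below collects the ends
  -- reached in this way.
  set Z : SimpleGraph V := SimpleGraph.fromEdgeSet {e | e ∈ G.edgeSet ∧ c e = 0} with hZ
  have hZchain : ∀ {u v : V}, Z.Reachable u v → ∃ q : Sym2 V → ZMod 2, SuppOn G q ∧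
      bdry q = Pi.single u 1 + Pi.single v 1 ∧ wt c q = 0 := by
    intro u v huv
    obtain ⟨q, hq, hqb⟩ := exists_chain_of_reachable huv
    rw [hZ] at hq
    have hq' : ∀ e, q e ≠ 0 → e ∈ G.edgeSet ∧ c e = 0 := by
      intro e he
      by_contra hn
      refine he (hq e fun h => hn ?_)
      rw [SimpleGraph.edgeSet_fromEdgeSet] at h
      exact h.1
    refine ⟨q, fun e he => ?_, hqb, Finset.sum_eq_zero fun e _ => ?_⟩
    · by_contra hn; exact he (hq' e hn).1
    · split_ifs with h
      · rfl
      · exact (hq' e h).2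
  set S : Finset V := Finset.univ.filter fun v => Z.Reachable b v with hS
  have hmemS : ∀ v, v ∈ S ↔ Z.Reachable b v := fun v => by simp [hS]
  have hbS : b ∈ S := (hmemS b).2 (SimpleGraph.Reachable.refl _)
  -- Otherwise a free path would close `f` to a chain with boundary `d` that is cheaper than `F₀`.
  have hxS : x ∉ S := by
    intro hx
    obtain ⟨q, hq, hqb, hqw⟩ := hZchain ((hmemS x).1 hx)
    have h1 := hmin (f + q) (hfG.add hq) (by
      rw [bdry_add, hfb, hqb]
      calc _ = d + (Pi.single x 1 + Pi.single x 1) + (Pi.single b 1 + Pi.single b 1) := by abel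
        _ = d := by rw [demand_add_self, demand_add_self, add_zero, add_zero])
    have h2 := wt_add_le hc hfG hq
    linarith
  have hcS : ∀ e ∈ cut G S, 0 < c e := by
    intro e he
    induction e with | _ p q
    obtain ⟨hpq, h⟩ := mk_mem_cut.1 he
    refine lt_of_le_of_ne (hc _ hpq) fun h0 => ?_
    have hadj : Z.Adj p q := by
      rw [hZ, SimpleGraph.fromEdgeSet_adj]; exact ⟨⟨hpq, h0.symm⟩, hpq.ne⟩
    rw [hmemS, hmemS] at h
    rcases h with ⟨h1, h2⟩ | ⟨h1, h2⟩
    · exact h2 (h1.trans hadj.reachable)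
    · exact h1 (h2.trans hadj.symm.reachable)
  -- If such a chain used a cut edge, deleting that edge and joining `u` to its end in `S` for free
  -- would give a competitor cheaper than `f`.
  have key : ∀ u ∈ S, ∀ h, SuppOn G h → bdry h = d + Pi.single x 1 + Pi.single u 1 →
      wt c h ≤ wt c f → ∀ e ∈ cut G S, h e = 0 := by
    intro u hu h hh hhb hhw e he
    by_contra hne
    obtain ⟨u', hu', w, hw, rfl⟩ := (Finset.mem_filter.1 he).2
    have heG : s(u', w) ∈ G.edgeSet := (mk_mem_cut.1 he).1
    obtain ⟨q, hq, hqb, hqw⟩ := hZchain (((hmemS u).1 hu).symm.trans ((hmemS u').1 hu'))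
    have h1 := hfmin (h + Pi.single s(u', w) 1 + q)
      ⟨(hh.add (SuppOn.single heG)).add hq, w, by
        rw [bdry_add, bdry_add, hhb, hqb, bdry_single heG.ne]
        calc _ = d + Pi.single x 1 + Pi.single w 1 + (Pi.single u 1 + Pi.single u 1) +
                (Pi.single u' 1 + Pi.single u' 1) := by abel
          _ = _ := by rw [demand_add_self, demand_add_self, add_zero, add_zero]⟩
    have h2 := wt_add_le hc (hh.add (SuppOn.single heG)) hq
    rw [wt_add_single c hne] at h2
    have h3 := hcS _ he
    linarith
  refine ⟨S, ?_, hcS, fun F hF hFb hFw => ?_⟩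
  · have h1 := sum_bdry hfG S
    rw [Finset.sum_eq_zero (key b hbS f hfG hfb le_rfl), hfb] at h1
    simp only [Pi.add_apply, Finset.sum_add_distrib, Pi.single_apply, Finset.sum_ite_eq', hbS,
      hxS, if_true, if_false, add_zero] at h1
    have : ∀ a : ZMod 2, a + 1 = 0 → a = 1 := by decide
    exact this _ h1
  -- Exchange `F` and `f` along a path `p` in their sum. Up to a free path, `f + p` has boundary `d`
  -- and costs at least `wt c F₀`, so `F + p` costs at most `wt c f`. By `key` it avoids the cut,
  -- hence `F` meets the cut only where `p` does.
  · obtain ⟨u, hu, p, hpK, hpb, hpc⟩ := exists_subpath (hF.add hfG) (x := x) (b := b) (by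
      rw [bdry_add, hFb, hfb]
      calc _ = (d + d) + (Pi.single x 1 + Pi.single b 1) := by abel
        _ = _ := by rw [demand_add_self, zero_add]) hbS hxS
    have hpG : SuppOn G p := fun e he => by
      by_contra hn; exact hpK e hn ((hF.add hfG) e he)
    obtain ⟨q, hq, hqb, hqw⟩ := hZchain ((hmemS u).1 hu)
    have h1 := wt_exchange c hpK
    have h2 := hmin (f + p + q) ((hfG.add hpG).add hq) (by
      rw [bdry_add, bdry_add, hfb, hpb, hqb]
      calc _ = d + (Pi.single x 1 + Pi.single x 1) + (Pi.single u 1 + Pi.single u 1) +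
              (Pi.single b 1 + Pi.single b 1) := by abel
        _ = d := by rw [demand_add_self, demand_add_self, demand_add_self, add_zero, add_zero,
                      add_zero])
    have h3 := wt_add_le hc (hfG.add hpG) hq
    have h4 := key u hu (F + p) (hF.add hpG) (by rw [bdry_add, hFb, hpb]; abel) (by linarith)
    refine (Finset.card_le_card fun e he => ?_).trans hpc
    rw [Finset.mem_filter] at he ⊢
    refine ⟨he.1, fun hp0 => he.2 ?_⟩
    have := h4 e he.1
    simpa [hp0] using this

/-! ### The Edmonds–Johnson inequality -/

lemma wt_sub_cut (c : Sym2 V → ℝ) (A : Finset (Sym2 V)) (ε : ℝ) (g : Sym2 V → ZMod 2) :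
    wt (fun e => c e - if e ∈ A then ε else 0) g =
      wt c g - ε * (A.filter (g · ≠ 0)).card := by
  have h : ε * ((A.filter (g · ≠ 0)).card : ℝ) =
      ∑ e, if g e = 0 then 0 else if e ∈ A then ε else 0 := by
    have : ∀ e, (if g e = 0 then 0 else if e ∈ A then ε else 0) =
        if e ∈ A.filter (g · ≠ 0) then ε else 0 := by
      intro e
      by_cases h1 : g e = 0 <;> by_cases h2 : e ∈ A <;> simp [h1, h2]
    simp_rw [this]
    rw [Finset.sum_ite_mem, Finset.univ_inter, Finset.sum_const, nsmul_eq_mul, mul_comm]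
  rw [h]
  unfold wt
  rw [← Finset.sum_sub_distrib]
  refine Finset.sum_congr rfl fun e _ => ?_
  by_cases h1 : g e = 0 <;> by_cases h2 : e ∈ A <;> simp [h1, h2]

/-- **Edmonds–Johnson**: the minimum cost of a join is at most the cost of every nonnegative vector
that covers all odd cuts. -/
theorem exists_chain_wt_le {G : SimpleGraph V} [DecidableRel G.Adj] (hG : G.Connected)
    {c : Sym2 V → ℝ} (hc : ∀ e ∈ G.edgeSet, 0 ≤ c e) {d : V → ZMod 2} (hd : ∑ v, d v = 0)
    {y : Sym2 V → ℝ} (hy0 : ∀ e ∈ G.edgeFinset, 0 ≤ y e)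
    (hy : ∀ S : Finset V, ∑ v ∈ S, d v = 1 → 1 ≤ ∑ e ∈ cut G S, y e) :
    ∃ f : Sym2 V → ZMod 2, SuppOn G f ∧ bdry f = d ∧ wt c f ≤ ∑ e ∈ G.edgeFinset, c e * y e := by
  classical
  set Fs : Finset (Sym2 V → ZMod 2) := Finset.univ.filter fun f => SuppOn G f ∧ bdry f = d with hFs
  have hmem : ∀ f, f ∈ Fs ↔ SuppOn G f ∧ bdry f = d := fun f => by simp [hFs]
  have hne : Fs.Nonempty := by
    obtain ⟨f, h1, h2⟩ := exists_chain_of_connected hG hd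
    exact ⟨f, (hmem f).2 ⟨h1, h2⟩⟩
  -- Costs off the edges of `G` may be negative; setting them to zero makes the box `[0, c₀]`
  -- nonempty.
  set c₀ : Sym2 V → ℝ := fun e => if e ∈ G.edgeFinset then c e else 0 with hc₀
  have hc₀0 : (0 : Sym2 V → ℝ) ≤ c₀ := fun e => by
    simp only [hc₀, Pi.zero_apply]
    split_ifs with h
    · exact hc e (SimpleGraph.mem_edgeFinset.1 h)
    · exact le_rfl
  have hwt₀ : ∀ f ∈ Fs, wt c₀ f = wt c f := fun f hf => Finset.sum_congr rfl fun e _ => by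
    by_cases he : e ∈ G.edgeSet
    · simp [hc₀, he]
    · simp [((hmem f).1 hf).1 e he]
  set τ : (Sym2 V → ℝ) → ℝ := fun c' => Fs.inf' hne (wt c') with hτ
  set L : (Sym2 V → ℝ) → ℝ := fun c' => ∑ e ∈ G.edgeFinset, c' e * y e with hL
  have hLc : Continuous L := by
    rw [hL]; fun_prop
  have hτc : Continuous τ := by
    refine Continuous.finset_inf'_apply hne fun f _ => ?_
    unfold wt
    refine continuous_finsetSum _ fun e _ => ?_
    split_ifs <;> fun_prop
  -- The factor `a > 1` makes the descent step below strict; it is removed at the end by letting `a`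
  -- tend to 1.
  have hmain : ∀ a : ℝ, 1 < a → τ c₀ ≤ a * L c₀ := by
    intro a ha
    obtain ⟨c', hc'mem, hc'min⟩ := (isCompact_Icc (a := (0 : Sym2 V → ℝ)) (b := c₀)).exists_isMinOn
      ⟨0, le_rfl, hc₀0⟩ (((hLc.const_mul a).sub hτc).continuousOn)
    have hL' : 0 ≤ L c' := Finset.sum_nonneg fun e he => mul_nonneg (hc'mem.1 e) (hy0 e he)
    -- Then the minimum of `a * L - τ` over the box is nonnegative, in particular its value at `c₀`.
    suffices h : τ c' ≤ 0 by
      have h1 := hc'min (show c₀ ∈ Set.Icc 0 c₀ from ⟨hc₀0, le_rfl⟩)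
      change a * L c' - τ c' ≤ a * L c₀ - τ c₀ at h1
      nlinarith [mul_nonneg (by linarith : (0 : ℝ) ≤ a) hL']
    by_contra! hpos
    obtain ⟨F₀, hF₀, hF₀τ⟩ := Finset.exists_mem_eq_inf' hne (wt c')
    change τ c' = wt c' F₀ at hF₀τ
    have hτle : ∀ g ∈ Fs, τ c' ≤ wt c' g := fun g hg => Finset.inf'_le _ hg
    obtain ⟨S, hS, hcS, hSF⟩ := exists_tight_cut (G := G) (c := c') (fun e _ => hc'mem.1 e)
      ((hmem _).1 hF₀).1 ((hmem _).1 hF₀).2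
      (fun g h1 h2 => hF₀τ ▸ hτle g ((hmem g).2 ⟨h1, h2⟩)) (hF₀τ ▸ hpos)
    -- Chains that are not minimum have slack for small `ε`; minimum ones lose at most `ε`, since
    -- they meet the cut at most once.
    have hev1 : ∀ᶠ ε : ℝ in nhdsWithin 0 (Set.Ioi 0), ∀ g ∈ Fs,
        τ c' - ε ≤ wt c' g - ε * ((cut G S).filter (g · ≠ 0)).card := by
      rw [Filter.eventually_all_finset]
      intro g hg
      rcases (hτle g hg).lt_or_eq with hlt | heq
      · refine Filter.Eventually.mono (p := fun ε : ℝ =>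
          τ c' - ε < wt c' g - ε * ((cut G S).filter (g · ≠ 0)).card) ?_ fun _ h => h.le
        refine Filter.Eventually.filter_mono nhdsWithin_le_nhds ?_
        refine ContinuousAt.eventually_lt (by fun_prop) (by fun_prop) ?_
        simpa using hlt
      · filter_upwards [self_mem_nhdsWithin] with ε hε
        have h1 : (((cut G S).filter (g · ≠ 0)).card : ℝ) ≤ 1 := by
          exact_mod_cast hSF g ((hmem g).1 hg).1 ((hmem g).1 hg).2 (by rw [← heq, hF₀τ])
        have h2 : (0 : ℝ) < ε := hε
        nlinarith
    have hev2 : ∀ᶠ ε : ℝ in nhdsWithin 0 (Set.Ioi 0), ∀ e ∈ cut G S, ε ≤ c' e := by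
      rw [Filter.eventually_all_finset]
      intro e he
      exact Filter.Eventually.filter_mono nhdsWithin_le_nhds (eventually_le_nhds (hcS e he))
    obtain ⟨ε, ⟨h1, h2⟩, hε⟩ := ((hev1.and hev2).and self_mem_nhdsWithin).exists
    have hε : (0 : ℝ) < ε := hε
    set c'' : Sym2 V → ℝ := fun e => c' e - if e ∈ cut G S then ε else 0 with hc''
    have hle := hc'min (show c'' ∈ Set.Icc 0 c₀ from ⟨fun e => by
      simp only [hc'', Pi.zero_apply]
      split_ifs with h
      · linarith [h2 e h]
      · simpa using hc'mem.1 e, fun e => by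
      have := hc'mem.2 e
      simp only [hc'']
      split_ifs <;> linarith⟩)
    change a * L c' - τ c' ≤ a * L c'' - τ c'' at hle
    have hτ'' : τ c' - ε ≤ τ c'' := by
      refine Finset.le_inf' hne _ fun g hg => ?_
      rw [hc'', wt_sub_cut]
      exact h1 g hg
    have hL'' : L c'' = L c' - ε * ∑ e ∈ cut G S, y e := by
      simp only [hL, hc'', sub_mul, Finset.sum_sub_distrib, ite_mul, zero_mul]
      rw [Finset.sum_ite_mem, Finset.inter_eq_right.2 cut_subset, Finset.mul_sum]
    -- Lowering the costs on the cut lowers `τ` by at most `ε` but `a * L` by at least `a * ε > ε`,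
    -- against the minimality of `c'`.
    have h3 : a * (ε * 1) ≤ a * (ε * ∑ e ∈ cut G S, y e) := by
      have := hy S hS
      gcongr
    rw [hL''] at hle
    nlinarith
  have hL0 : 0 ≤ L c₀ := Finset.sum_nonneg fun e he => mul_nonneg (hc₀0 e) (hy0 e he)
  have hfin : τ c₀ ≤ L c₀ := by
    refine le_of_forall_pos_le_add fun δ hδ => ?_
    -- This factor exceeds 1 by so little that the excess is at most `δ`; the `+ 1` in the
    -- denominator covers `L c₀ = 0`.
    have h1 := hmain (1 + δ / (L c₀ + 1)) (by have : 0 < δ / (L c₀ + 1) := by positivity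
                                              linarith)
    have h2 : δ / (L c₀ + 1) * L c₀ ≤ δ := by
      rw [div_mul_eq_mul_div, div_le_iff₀ (by linarith)]
      nlinarith
    linarith
  obtain ⟨f, hf, hfτ⟩ := Finset.exists_mem_eq_inf' hne (wt c₀)
  refine ⟨f, ((hmem f).1 hf).1, ((hmem f).1 hf).2, ?_⟩
  rw [← hwt₀ f hf, ← hfτ]
  refine hfin.trans (le_of_eq (Finset.sum_congr rfl fun e he => ?_))
  simp [hc₀, SimpleGraph.mem_edgeFinset.1 he]

/-! ### Joins and nodes of wrong degree -/

/-- The mod 2 chain of a multiset of edges. -/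
def chain (M : Multiset (Sym2 V)) (e : Sym2 V) : ZMod 2 := (M.count e : ZMod 2)

/-- The mod 2 indicator of a set of nodes. -/
def demand (D : Finset V) (v : V) : ZMod 2 := if v ∈ D then 1 else 0

/-- The support of a chain. -/
def chainSupport (f : Sym2 V → ZMod 2) : Finset (Sym2 V) := Finset.univ.filter (f · ≠ 0)

lemma bdry_chain (M : Multiset (Sym2 V)) (v : V) : bdry (chain M) v = (deg M v : ZMod 2) := by
  induction M using Multiset.induction_on with
  | empty => simp [bdry, chain, deg]
  | cons a M ih =>
    have hadd : chain (a ::ₘ M) = chain M + Pi.single a 1 := by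
      ext e
      by_cases h : e = a <;> simp [chain, h]
    have hs : bdry (Pi.single a 1 : Sym2 V → ZMod 2) v = if v ∈ a then 1 else 0 := by
      simp only [bdry, Pi.single_apply]
      rw [Finset.sum_eq_single a]
      · simp
      · intro e _ he; simp [he]
      · simp
    rw [hadd, bdry_add, Pi.add_apply, hs, ih, deg, deg, Multiset.countP_cons]
    push_cast
    rfl

lemma chain_val_chainSupport (f : Sym2 V → ZMod 2) : chain (chainSupport f).val = f := by
  ext e
  have key : ∀ a : ZMod 2, a ≠ 0 → (1 : ZMod 2) = a := by decide
  by_cases h : f e = 0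
  · have : e ∉ chainSupport f := by simp [chainSupport, h]
    rw [chain, Multiset.count_eq_zero_of_notMem this, h, Nat.cast_zero]
  · have : e ∈ chainSupport f := by simp [chainSupport, h]
    rw [chain, Multiset.count_eq_one_of_mem (Finset.nodup _) this, Nat.cast_one]
    exact key _ h

lemma cost_chainSupport (c : Sym2 V → ℝ) (f : Sym2 V → ZMod 2) :
    cost c (chainSupport f).val = wt c f := by
  change ∑ e ∈ chainSupport f, c e = _
  rw [chainSupport, Finset.sum_filter]
  exact Finset.sum_congr rfl fun e _ => by by_cases h : f e = 0 <;> simp [h]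

lemma suppOn_chain {G : SimpleGraph V} {M : Multiset (Sym2 V)} (hM : ∀ e ∈ M, e ∈ G.edgeSet) :
    SuppOn G (chain M) := fun e he => by
  rw [chain, Multiset.count_eq_zero_of_notMem fun h => he (hM e h), Nat.cast_zero]

/-- Reduction mod 2 drops parallel copies of edges, whose cost is nonnegative. Hence a cheapest
chain yields a cheapest join among all multisets. -/
lemma wt_chain_le {G : SimpleGraph V} {c : Sym2 V → ℝ} (hc : ∀ e ∈ G.edgeSet, 0 ≤ c e)
    {M : Multiset (Sym2 V)} (hM : ∀ e ∈ M, e ∈ G.edgeSet) : wt c (chain M) ≤ cost c M := by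
  have : cost c M = ∑ e, M.count e • c e := by
    rw [cost, Finset.sum_multiset_map_count]
    refine Finset.sum_subset (Finset.subset_univ _) fun e _ he => ?_
    rw [Multiset.count_eq_zero_of_notMem (fun h => he (Multiset.mem_toFinset.2 h)), zero_smul]
  rw [this]
  refine Finset.sum_le_sum fun e _ => ?_
  by_cases he : e ∈ M
  · have h1 := hc e (hM e he)
    have h2 : (1 : ℝ) ≤ M.count e := by exact_mod_cast Multiset.one_le_count_iff_mem.2 he
    rw [nsmul_eq_mul]
    split_ifs <;> nlinarith
  · simp [chain, Multiset.count_eq_zero_of_notMem he]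

lemma isJoin_iff {G : SimpleGraph V} {D : Finset V} {M : Multiset (Sym2 V)} :
    IsJoin G D M ↔ (∀ e ∈ M, e ∈ G.edgeSet) ∧ bdry (chain M) = demand D := by
  refine and_congr_right fun _ => ?_
  rw [funext_iff]
  refine forall_congr' fun v => ?_
  rw [bdry_chain, demand, ← ZMod.natCast_eq_one_iff_odd]
  have key : ∀ a : ZMod 2, a = 1 ↔ ¬ a = 0 := by decide
  by_cases h : v ∈ D
  · simp [h]
  · simp [h, key]

lemma isJoin_chainSupport {G : SimpleGraph V} {D : Finset V} {f : Sym2 V → ZMod 2}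
    (hf : SuppOn G f) (hb : bdry f = demand D) : IsJoin G D (chainSupport f).val := by
  rw [isJoin_iff, chain_val_chainSupport]
  refine ⟨fun e he => ?_, hb⟩
  by_contra h
  exact (Finset.mem_filter.1 (show e ∈ chainSupport f from he)).2 (hf e h)

/-- Minimum-cost joins exist for even sets of nodes. -/
lemma exists_isMinCostJoin {G : SimpleGraph V} (hG : G.Connected) {c : Sym2 V → ℝ}
    (hc : ∀ e ∈ G.edgeSet, 0 ≤ c e) {D : Finset V} (hD : ∑ v, demand D v = 0) :
    ∃ M, IsMinCostJoin G c D M := by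
  obtain ⟨f, ⟨hf, hfb⟩, hmin⟩ := Set.exists_min_image
    {f : Sym2 V → ZMod 2 | SuppOn G f ∧ bdry f = demand D} (wt c) (Set.toFinite _)
    (exists_chain_of_connected hG hD)
  refine ⟨_, isJoin_chainSupport hf hfb, fun M' hM' => ?_⟩
  rw [cost_chainSupport]
  rw [isJoin_iff] at hM'
  exact (hmin _ ⟨suppOn_chain hM'.1, hM'.2⟩).trans (wt_chain_le hc hM'.1)

/-- A minimum-cost join costs at most as much as any nonnegative vector covering the odd cuts. -/
lemma IsMinCostJoin.cost_le {G : SimpleGraph V} [DecidableRel G.Adj] (hG : G.Connected)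
    {c : Sym2 V → ℝ} (hc : ∀ e ∈ G.edgeSet, 0 ≤ c e) {D : Finset V} (hD : ∑ v, demand D v = 0)
    {M : Multiset (Sym2 V)} (hM : IsMinCostJoin G c D M)
    {y : Sym2 V → ℝ} (hy0 : ∀ e ∈ G.edgeFinset, 0 ≤ y e)
    (hy : ∀ S : Finset V, ∑ v ∈ S, demand D v = 1 → 1 ≤ ∑ e ∈ cut G S, y e) :
    cost c M ≤ ∑ e ∈ G.edgeFinset, c e * y e := by
  obtain ⟨f, hf, hfb, hfw⟩ := exists_chain_wt_le hG hc hD hy0 hy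
  refine (hM.2 _ (isJoin_chainSupport hf hfb)).trans ?_
  rwa [cost_chainSupport]

lemma demand_wrongDegree (T : Finset V) (J : Finset (Sym2 V)) :
    demand (wrongDegree T J) = demand T + bdry (chain J.val) := by
  ext v
  rw [Pi.add_apply, bdry_chain]
  simp only [demand, wrongDegree, Finset.mem_filter, Finset.mem_univ, true_and]
  have h11 : (1 + 1 : ZMod 2) = 0 := rfl
  by_cases hT : v ∈ T <;> rcases Nat.even_or_odd (deg J.val v) with h | h
  · simp [hT, h, (ZMod.natCast_eq_zero_iff_even).2 h]
  · simp [hT, Nat.not_even_iff_odd.2 h, (ZMod.natCast_eq_one_iff_odd).2 h, h11]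
  · simp [hT, Nat.not_odd_iff_even.2 h, (ZMod.natCast_eq_zero_iff_even).2 h]
  · simp [hT, h, (ZMod.natCast_eq_one_iff_odd).2 h]

lemma sum_demand (S T : Finset V) : ∑ v ∈ S, demand T v = ((S ∩ T).card : ZMod 2) := by
  simp only [demand]
  rw [Finset.sum_ite_mem]
  simp

/-- Summing the boundary of `J` over `S` leaves the tree edges in the cut. So a wrong-odd set is
either `T`-even with an odd number of tree edges in its cut, or `T`-odd with an even number. -/
lemma sum_demand_wrongDegree {G : SimpleGraph V} [DecidableRel G.Adj] (T : Finset V)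
    {J : Finset (Sym2 V)} (hJ : ∀ e ∈ J, e ∈ G.edgeSet) (S : Finset V) :
    ∑ v ∈ S, demand (wrongDegree T J) v =
      ((S ∩ T).card : ZMod 2) + ((cut G S ∩ J).card : ZMod 2) := by
  rw [demand_wrongDegree]
  simp only [Pi.add_apply]
  rw [Finset.sum_add_distrib, sum_demand, sum_bdry (suppOn_chain hJ)]
  congr 1
  have : ∀ e, chain J.val e = if e ∈ J then 1 else 0 := fun e => by
    rw [chain, Multiset.count_eq_of_nodup J.nodup]
    simp
  simp_rw [this]
  rw [Finset.sum_ite_mem]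
  simp

lemma cut_univ {G : SimpleGraph V} [DecidableRel G.Adj] : cut G Finset.univ = ∅ := by
  ext e
  induction e with | _ a b
  simp [mk_mem_cut]

lemma sum_demand_wrongDegree_univ {G : SimpleGraph V} [DecidableRel G.Adj] {T : Finset V}
    (hT : Even T.card) {J : Finset (Sym2 V)} (hJ : ∀ e ∈ J, e ∈ G.edgeSet) :
    ∑ v, demand (wrongDegree T J) v = 0 := by
  rw [sum_demand_wrongDegree T hJ, cut_univ]
  simpa using ZMod.natCast_eq_zero_iff_even.2 hT

/-- Adding a join of the wrong-degree nodes to a spanning tree gives a connected `T`-join. -/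
lemma isConnectedJoin_solution {G : SimpleGraph V} {T : Finset V} {J : Finset (Sym2 V)}
    {M : Multiset (Sym2 V)} (hJ : IsSpanningTree G J) (hM : IsJoin G (wrongDegree T J) M) :
    IsConnectedJoin G T (solution J M) := by
  rw [isJoin_iff] at hM
  refine ⟨isJoin_iff.2 ⟨fun e he => ?_, ?_⟩, hJ.2.connected.mono ?_⟩
  · rcases Multiset.mem_add.1 he with h | h
    · exact hJ.1 e h
    · exact hM.1 e h
  · have : chain (solution J M) = chain J.val + chain M := by
      ext e; simp [chain, solution]
    rw [this, bdry_add, hM.2, demand_wrongDegree, add_comm, add_assoc, demand_add_self, add_zero]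
  · refine SimpleGraph.fromEdgeSet_mono fun e he => ?_
    exact Multiset.mem_add.2 (Or.inl he)

/-! ### Connectivity and counting edges -/

lemma card_edgeSet_fromEdgeSet_le (J : Finset (Sym2 V)) :
    Nat.card (SimpleGraph.fromEdgeSet (J : Set (Sym2 V))).edgeSet ≤ J.card := by
  rw [SimpleGraph.edgeSet_fromEdgeSet, Nat.card_coe_set_eq, ← Set.ncard_coe_finset J]
  exact Set.ncard_le_ncard Set.sdiff_subset

lemma card_le_card_add_one {J : Finset (Sym2 V)}
    (h : (SimpleGraph.fromEdgeSet (J : Set (Sym2 V))).Connected) : Fintype.card V ≤ J.card + 1 := by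
  have := h.card_vert_le_card_edgeSet_add_one
  rw [Nat.card_eq_fintype_card] at this
  exact this.trans (by gcongr; exact card_edgeSet_fromEdgeSet_le J)

lemma edgeSet_fromEdgeSet_of_subset {G : SimpleGraph V} {J : Finset (Sym2 V)}
    (hJ : ∀ e ∈ J, e ∈ G.edgeSet) :
    (SimpleGraph.fromEdgeSet (J : Set (Sym2 V))).edgeSet = J := by
  rw [SimpleGraph.edgeSet_fromEdgeSet]
  ext e
  simp only [Set.mem_sdiff, Finset.mem_coe]
  exact ⟨fun h => h.1, fun h => ⟨h, G.not_isDiag_of_mem_edgeSet (hJ e h)⟩⟩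

lemma isSpanningTree_iff {G : SimpleGraph V} {J : Finset (Sym2 V)} :
    IsSpanningTree G J ↔ (∀ e ∈ J, e ∈ G.edgeSet) ∧
      (SimpleGraph.fromEdgeSet (J : Set (Sym2 V))).Connected ∧ J.card + 1 = Fintype.card V := by
  refine and_congr_right fun hJ => ?_
  rw [SimpleGraph.isTree_iff_connected_and_card, edgeSet_fromEdgeSet_of_subset hJ,
    Nat.card_eq_fintype_card]
  simp

lemma exists_isSpanningTree {G : SimpleGraph V} (hG : G.Connected) : ∃ J, IsSpanningTree G J := by
  classical
  obtain ⟨F, hF, hFt⟩ := hG.exists_isTree_le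
  refine ⟨F.edgeFinset, fun e he => ?_, ?_⟩
  · exact SimpleGraph.edgeSet_mono hF (SimpleGraph.mem_edgeFinset.1 he)
  · rwa [SimpleGraph.coe_edgeFinset, SimpleGraph.fromEdgeSet_edgeSet]

/-- The edges of a connected graph whose ends are in different classes connect the classes. -/
lemma card_image_le_card_crossing {X : Type*} [DecidableEq X] {J : Finset (Sym2 V)}
    (h : (SimpleGraph.fromEdgeSet (J : Set (Sym2 V))).Connected) (q : V → X) :
    (Finset.univ.image q).card ≤ (J.filter fun e => ¬ (e.map q).IsDiag).card + 1 := by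
  classical
  set Y := Finset.univ.image q with hY
  let q' : V → Y := fun v => ⟨q v, Finset.mem_image_of_mem q (Finset.mem_univ v)⟩
  have hq' : Function.Surjective q' := by
    rintro ⟨x, hx⟩
    obtain ⟨v, -, rfl⟩ := Finset.mem_image.1 hx
    exact ⟨v, rfl⟩
  -- Contracting the classes of `q` keeps the graph connected, and only the images of the crossing
  -- edges remain.
  set J' : Finset (Sym2 Y) := (J.filter fun e => ¬ (e.map q).IsDiag).image (Sym2.map q') with hJ'
  set H := SimpleGraph.fromEdgeSet (J' : Set (Sym2 Y)) with hH
  have hreach : ∀ a b, (SimpleGraph.fromEdgeSet (J : Set (Sym2 V))).Reachable a b →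
      H.Reachable (q' a) (q' b) := by
    rintro a b ⟨p⟩
    induction p with
    | nil => exact SimpleGraph.Reachable.refl _
    | @cons a b w hab p ih =>
      refine SimpleGraph.Reachable.trans ?_ ih
      by_cases hq : q a = q b
      · rw [show q' a = q' b from Subtype.ext hq]
      · refine SimpleGraph.Adj.reachable ?_
        rw [hH, SimpleGraph.fromEdgeSet_adj]
        refine ⟨?_, fun h => hq (congrArg Subtype.val h)⟩
        rw [hJ', Finset.mem_coe, Finset.mem_image]
        refine ⟨s(a, b), Finset.mem_filter.2 ⟨?_, by simpa using hq⟩, rfl⟩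
        exact ((SimpleGraph.fromEdgeSet_adj _).1 hab).1
  obtain ⟨v₀⟩ := h.nonempty
  have hconn : H.Connected := by
    have : Nonempty Y := ⟨q' v₀⟩
    refine ⟨fun x y => ?_⟩
    obtain ⟨a, rfl⟩ := hq' x
    obtain ⟨b, rfl⟩ := hq' y
    exact hreach a b (h.preconnected a b)
  have := card_le_card_add_one hconn
  rw [Fintype.card_coe] at this
  exact this.trans (by gcongr; exact Finset.card_image_le)

/-- A graph with `n` nodes and `m` edges has at least `n - m` components. -/
lemma card_le_card_add_card_components [Nonempty V] (J : Finset (Sym2 V)) :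
    Fintype.card V ≤ J.card +
      Nat.card (SimpleGraph.fromEdgeSet (J : Set (Sym2 V))).ConnectedComponent := by
  classical
  set K := SimpleGraph.fromEdgeSet (J : Set (Sym2 V)) with hK
  obtain ⟨v₀⟩ := ‹Nonempty V›
  have : Fintype K.ConnectedComponent := Fintype.ofFinite _
  choose rep hrep using fun C : K.ConnectedComponent => C.exists_rep
  -- One edge from `v₀` to each of the other components makes the graph connected.
  set R : Finset (Sym2 V) :=
    (Finset.univ.erase (K.connectedComponentMk v₀)).image fun C => s(v₀, rep C) with hR
  have hconn : (SimpleGraph.fromEdgeSet ((J ∪ R : Finset (Sym2 V)) : Set (Sym2 V))).Connected := by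
    have hle : K ≤ SimpleGraph.fromEdgeSet ((J ∪ R : Finset (Sym2 V)) : Set (Sym2 V)) :=
      SimpleGraph.fromEdgeSet_mono (by simp)
    have h0 : ∀ v, (SimpleGraph.fromEdgeSet ((J ∪ R : Finset (Sym2 V)) : Set (Sym2 V))).Reachable
        v₀ v := by
      intro v
      by_cases hv : K.connectedComponentMk v = K.connectedComponentMk v₀
      · exact (SimpleGraph.ConnectedComponent.exact hv.symm).mono hle
      · have h1 : K.Reachable (rep (K.connectedComponentMk v)) v :=
          SimpleGraph.ConnectedComponent.exact (hrep _)
        refine SimpleGraph.Reachable.trans (SimpleGraph.Adj.reachable ?_) (h1.mono hle)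
        rw [SimpleGraph.fromEdgeSet_adj]
        refine ⟨?_, fun h => hv ?_⟩
        · rw [Finset.mem_coe, Finset.mem_union, hR, Finset.mem_image]
          exact Or.inr ⟨_, by simp [hv], rfl⟩
        · rw [h]
          exact (hrep _).symm
    have : Nonempty V := ⟨v₀⟩
    exact ⟨fun a b => (h0 a).symm.trans (h0 b)⟩
  have h1 := card_le_card_add_one hconn
  have h2 : (J ∪ R).card ≤ J.card + R.card := Finset.card_union_le _ _
  have h3 : R.card ≤ (Finset.univ.erase (K.connectedComponentMk v₀)).card := Finset.card_image_le
  rw [Finset.card_erase_of_mem (Finset.mem_univ _), Finset.card_univ] at h3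
  have h4 : 0 < Fintype.card K.ConnectedComponent :=
    Fintype.card_pos_iff.2 ⟨K.connectedComponentMk v₀⟩
  rw [Nat.card_eq_fintype_card]
  omega

/-! ### Minimum-weight trees and Edmonds' decomposition -/

/-- Exchanging an edge on the tree path between the ends of `s(a, b)`. -/
lemma IsSpanningTree.exchange {G : SimpleGraph V} {J : Finset (Sym2 V)} (hJ : IsSpanningTree G J)
    {a b : V} (hab : G.Adj a b) (heJ : s(a, b) ∉ J)
    {p : (SimpleGraph.fromEdgeSet (J : Set (Sym2 V))).Walk a b} (hp : p.IsPath) {e : Sym2 V}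
    (he : e ∈ p.edges) : e ∈ J ∧ IsSpanningTree G (insert s(a, b) (J.erase e)) := by
  have heJ' : e ∈ J := by
    have := p.edges_subset_edgeSet he
    rwa [edgeSet_fromEdgeSet_of_subset hJ.1] at this
  refine ⟨heJ', ?_⟩
  obtain ⟨h1, h2, h3⟩ := isSpanningTree_iff.1 hJ
  refine isSpanningTree_iff.2 ⟨fun f hf => ?_, ?_, ?_⟩
  · rcases Finset.mem_insert.1 hf with rfl | hf
    · exact hab
    · exact h1 f (Finset.mem_of_mem_erase hf)
  · set H := SimpleGraph.fromEdgeSet ((insert s(a, b) J : Finset (Sym2 V)) : Set (Sym2 V)) with hH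
    have hle : SimpleGraph.fromEdgeSet (J : Set (Sym2 V)) ≤ H :=
      SimpleGraph.fromEdgeSet_mono (by simp)
    have hba : H.Adj b a := by
      rw [hH, SimpleGraph.fromEdgeSet_adj]
      exact ⟨by simp [Sym2.eq_swap], hab.ne.symm⟩
    -- The edge `e` lies on the cycle closed by `s(a, b)`, so it is no bridge and can be deleted.
    have hcyc : (SimpleGraph.Walk.cons hba (p.mapLe hle)).IsCycle := by
      rw [SimpleGraph.Walk.cons_isCycle_iff]
      refine ⟨hp.mapLe hle, fun h => heJ ?_⟩
      rw [SimpleGraph.Walk.edges_mapLe_eq_edges] at h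
      have := p.edges_subset_edgeSet h
      rw [edgeSet_fromEdgeSet_of_subset hJ.1, Sym2.eq_swap] at this
      exact this
    have hnb : ¬ H.IsBridge e := fun hb => hb.notMem_edges_of_isCycle hcyc (by
      rw [SimpleGraph.Walk.edges_cons, SimpleGraph.Walk.edges_mapLe_eq_edges]
      exact List.mem_cons_of_mem _ he)
    induction e with | _ x y
    refine ((h2.mono hle).connected_delete_edge_of_not_isBridge hnb).mono ?_
    rw [hH, SimpleGraph.deleteEdges_fromEdgeSet]
    refine SimpleGraph.fromEdgeSet_mono fun f hf => ?_
    simp only [Set.mem_sdiff, Finset.mem_coe, Finset.mem_insert, Set.mem_singleton_iff] at hf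
    simp only [Finset.mem_coe, Finset.mem_insert, Finset.mem_erase]
    tauto
  · rw [Finset.card_insert_of_notMem fun h => heJ (Finset.mem_of_mem_erase h),
      Finset.card_erase_of_mem heJ']
    have : 0 < J.card := Finset.card_pos.2 ⟨e, heJ'⟩
    omega

/-- In a minimum-weight spanning tree the ends of an edge are joined by tree edges that are not
heavier. -/
lemma IsSpanningTree.reachable_of_minimal {G : SimpleGraph V} {w : Sym2 V → ℝ}
    {J : Finset (Sym2 V)} (hJ : IsSpanningTree G J)
    (hmin : ∀ J', IsSpanningTree G J' → ∑ e ∈ J, w e ≤ ∑ e ∈ J', w e) {t : ℝ} {a b : V}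
    (hab : G.Adj a b) (ht : w s(a, b) < t) :
    (SimpleGraph.fromEdgeSet ((J.filter (w · < t) : Finset (Sym2 V)) : Set (Sym2 V))).Reachable
      a b := by
  classical
  by_cases heJ : s(a, b) ∈ J
  · refine SimpleGraph.Adj.reachable ?_
    rw [SimpleGraph.fromEdgeSet_adj]
    exact ⟨by simp [heJ, ht], hab.ne⟩
  obtain ⟨p, hp⟩ := (hJ.2.connected.preconnected a b).exists_isPath
  -- Exchanging `e` for `s(a, b)` cannot make a minimum tree lighter, so `w e ≤ w s(a, b)`.
  have hlt : ∀ e ∈ p.edges, w e < t := by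
    intro e he
    obtain ⟨heJ', hJ'⟩ := hJ.exchange hab heJ hp he
    have h1 := hmin _ hJ'
    rw [Finset.sum_insert fun h => heJ (Finset.mem_of_mem_erase h)] at h1
    have h2 := Finset.add_sum_erase J w heJ'
    linarith
  refine ⟨p.transfer _ fun e he => ?_⟩
  have := p.edges_subset_edgeSet he
  rw [SimpleGraph.edgeSet_fromEdgeSet] at this ⊢
  refine ⟨?_, this.2⟩
  simp only [Finset.coe_filter]
  exact ⟨this.1, hlt e he⟩

/-- If all sums of `g` over strict lower level sets of `w` are nonpositive, then
`∑ w g ≥ M ∑ g` for every upper bound `M` of `w`. -/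
lemma mul_sum_le_sum_mul_of_levels {ι : Type*} [DecidableEq ι] (w g : ι → ℝ) (E : Finset ι)
    (h : ∀ t, ∑ e ∈ E.filter (w · < t), g e ≤ 0) (M : ℝ) (hM : ∀ e ∈ E, w e ≤ M) :
    M * ∑ e ∈ E, g e ≤ ∑ e ∈ E, w e * g e := by
  induction E using Finset.strongInduction generalizing M with
  | H E ih =>
    rcases E.eq_empty_or_nonempty with rfl | hne
    · simp
    obtain ⟨e₀, he₀, hmax⟩ := E.exists_max_image w hne
    -- Peel off the top level of `w`, where `w` is constantly `w e₀`. Below it induction applies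
    -- with the bound `w e₀`; raising `w e₀` to `M` lowers the left side, because `∑ g ≤ 0`.
    set E' := E.filter (w · < w e₀) with hE'
    have hsub : E' ⊂ E := Finset.filter_ssubset.2 ⟨e₀, he₀, lt_irrefl _⟩
    have hih := ih E' hsub (fun t => by
      have : E'.filter (w · < t) = E.filter (w · < min (w e₀) t) := by
        rw [hE', Finset.filter_filter]
        exact Finset.filter_congr fun e _ => by rw [lt_min_iff]
      rw [this]
      exact h _) (w e₀) (fun e he => (Finset.mem_filter.1 he).2.le)
    have hsplit : ∀ φ : ι → ℝ, ∑ e ∈ E, φ e =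
        ∑ e ∈ E', φ e + ∑ e ∈ E.filter (fun e => ¬ w e < w e₀), φ e := fun φ =>
      (Finset.sum_filter_add_sum_filter_not E (w · < w e₀) φ).symm
    have hrest : ∑ e ∈ E.filter (fun e => ¬ w e < w e₀), w e * g e =
        w e₀ * ∑ e ∈ E.filter (fun e => ¬ w e < w e₀), g e := by
      rw [Finset.mul_sum]
      refine Finset.sum_congr rfl fun e he => ?_
      rw [Finset.mem_filter, not_lt] at he
      rw [le_antisymm (hmax e he.1) he.2]
    have htot : ∑ e ∈ E, g e ≤ 0 := by
      have := h (w e₀ + 1)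
      rwa [Finset.filter_true_of_mem fun e he => by linarith [hmax e he]] at this
    have hge : w e₀ ≤ M := hM e₀ he₀
    rw [hsplit (fun e => w e * g e), hrest]
    have h1 := mul_le_mul_of_nonpos_right hge htot
    have h2 := congrArg (w e₀ * ·) (hsplit g)
    simp only [mul_add] at h2
    linarith

/-- The subtour constraints omit `univ`, which `total` covers, and singletons, which contain no
edge. -/
lemma IsFeasible.sum_edgesInside_le {G : SimpleGraph V} [DecidableRel G.Adj] {T : Finset V}
    {x : Sym2 V → ℝ} (hx : IsFeasible G T x) {S : Finset V} (hS : S.Nonempty) :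
    ∑ e ∈ edgesInside G S, x e ≤ (S.card : ℝ) - 1 := by
  by_cases h1 : S = Finset.univ
  · subst h1
    rw [hx.total, Finset.card_univ]
  by_cases h2 : 2 ≤ S.card
  · exact hx.subtour S h1 h2
  have h3 : S.card = 1 := by
    have := hS.card_pos
    omega
  obtain ⟨v, rfl⟩ := Finset.card_eq_one.1 h3
  have : edgesInside G {v} = ∅ := by
    ext e
    induction e with | _ a b
    simp only [mk_mem_edgesInside, Finset.mem_singleton, Finset.notMem_empty, iff_false]
    rintro ⟨h, rfl, rfl⟩
    exact h.ne rfl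
  simp [this]

lemma edgesInside_univ (G : SimpleGraph V) [DecidableRel G.Adj] :
    edgesInside G Finset.univ = G.edgeFinset := by
  ext e
  induction e with | _ a b
  simp [mk_mem_edgesInside]

/-- A set of edges inside the components of a forest has at most the rank as its value. -/
lemma IsFeasible.sum_le_card_of_reachable {G : SimpleGraph V} [DecidableRel G.Adj] {T : Finset V}
    {x : Sym2 V → ℝ} (hx : IsFeasible G T x) [Nonempty V] {A : Finset (Sym2 V)}
    (hA : A ⊆ G.edgeFinset) {J : Finset (Sym2 V)}
    (hAJ : ∀ a b, s(a, b) ∈ A → (SimpleGraph.fromEdgeSet (J : Set (Sym2 V))).Reachable a b) :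
    ∑ e ∈ A, x e ≤ J.card := by
  classical
  set K := SimpleGraph.fromEdgeSet (J : Set (Sym2 V)) with hK
  have : Fintype K.ConnectedComponent := Fintype.ofFinite _
  set S : K.ConnectedComponent → Finset V :=
    fun C => Finset.univ.filter fun v => K.connectedComponentMk v = C with hS
  have hmem : ∀ C v, v ∈ S C ↔ K.connectedComponentMk v = C := fun C v => by simp [hS]
  have hdisj : ∀ C ∈ (Finset.univ : Finset K.ConnectedComponent), ∀ C' ∈ Finset.univ, C ≠ C' →
      Disjoint (edgesInside G (S C)) (edgesInside G (S C')) := by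
    intro C _ C' _ hne
    rw [Finset.disjoint_left]
    intro e h1 h2
    induction e with | _ a b
    rw [mk_mem_edgesInside, hmem, hmem] at h1 h2
    exact hne (h1.2.1.symm.trans h2.2.1)
  have hsub : A ⊆ Finset.univ.biUnion fun C => edgesInside G (S C) := by
    intro e he
    induction e with | _ a b
    rw [Finset.mem_biUnion]
    refine ⟨K.connectedComponentMk a, Finset.mem_univ _, mk_mem_edgesInside.2
      ⟨SimpleGraph.mem_edgeFinset.1 (hA he), (hmem _ _).2 rfl, (hmem _ _).2 ?_⟩⟩
    exact SimpleGraph.ConnectedComponent.sound (hAJ a b he).symm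
  have h1 : ∑ e ∈ A, x e ≤ ∑ C : K.ConnectedComponent, ∑ e ∈ edgesInside G (S C), x e := by
    rw [← Finset.sum_biUnion hdisj]
    refine Finset.sum_le_sum_of_subset_of_nonneg hsub fun e he _ => hx.nonneg e ?_
    obtain ⟨C, -, hC⟩ := Finset.mem_biUnion.1 he
    exact Finset.filter_subset _ _ hC
  have h2 : ∑ C : K.ConnectedComponent, ∑ e ∈ edgesInside G (S C), x e ≤
      ∑ C : K.ConnectedComponent, (((S C).card : ℝ) - 1) := by
    refine Finset.sum_le_sum fun C _ => hx.sum_edgesInside_le ?_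
    obtain ⟨v, hv⟩ := C.exists_rep
    exact ⟨v, (hmem _ _).2 hv⟩
  have h3 : Fintype.card V = ∑ C : K.ConnectedComponent, (S C).card := by
    rw [← Finset.card_univ]
    exact Finset.card_eq_sum_card_fiberwise fun v _ => Finset.mem_coe.2 (Finset.mem_univ _)
  -- The sum of `|C| - 1` over the components is `|V|` minus their number, hence at most `|J|`.
  have h4 := card_le_card_add_card_components J
  rw [← hK, Nat.card_eq_fintype_card, h3] at h4
  rw [Finset.sum_sub_distrib, Finset.sum_const, Finset.card_univ, nsmul_eq_mul, mul_one] at h2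
  have h5 : ∑ C : K.ConnectedComponent, ((S C).card : ℝ) ≤
      J.card + Fintype.card K.ConnectedComponent := by exact_mod_cast h4
  linarith

/-- A minimum-weight spanning tree is at most as heavy as any feasible vector. -/
lemma IsFeasible.exists_tree_le {G : SimpleGraph V} [DecidableRel G.Adj] (hG : G.Connected)
    {T : Finset V} {x : Sym2 V → ℝ} (hx : IsFeasible G T x) (w : Sym2 V → ℝ) :
    ∃ J, IsSpanningTree G J ∧ ∑ e ∈ J, w e ≤ ∑ e ∈ G.edgeFinset, w e * x e := by
  classical
  have := hG.nonempty
  obtain ⟨J, hJ, hmin⟩ := Set.exists_min_image {J : Finset (Sym2 V) | IsSpanningTree G J}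
    (fun J => ∑ e ∈ J, w e) (Set.toFinite _) (exists_isSpanningTree hG)
  refine ⟨J, hJ, ?_⟩
  have hJE : J ⊆ G.edgeFinset := fun e he => SimpleGraph.mem_edgeFinset.2 (hJ.1 e he)
  have hsumJ : ∀ (φ : Sym2 V → ℝ) (A : Finset (Sym2 V)),
      ∑ e ∈ A, φ e * (if e ∈ J then 1 else 0) = ∑ e ∈ A ∩ J, φ e := by
    intro φ A
    simp only [mul_ite, mul_one, mul_zero]
    rw [Finset.sum_ite_mem]
  -- Edges lighter than `t` lie inside the components of the tree edges lighter than `t`, so the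
  -- rank bound applies.
  have hlev : ∀ t, ∑ e ∈ G.edgeFinset.filter (w · < t), (x e - if e ∈ J then 1 else 0) ≤ 0 := by
    intro t
    have h1 := hx.sum_le_card_of_reachable (A := G.edgeFinset.filter (w · < t))
      (J := J.filter (w · < t)) (Finset.filter_subset _ _) fun a b hab => by
        rw [Finset.mem_filter, SimpleGraph.mem_edgeFinset] at hab
        exact hJ.reachable_of_minimal (fun J' hJ' => hmin J' hJ') hab.1 hab.2
    have h2 := hsumJ (fun _ => 1) (G.edgeFinset.filter (w · < t))
    have h3 : G.edgeFinset.filter (w · < t) ∩ J = J.filter (w · < t) := by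
      ext e
      simp only [Finset.mem_inter, Finset.mem_filter]
      exact ⟨fun h => ⟨h.2, h.1.2⟩, fun h => ⟨⟨hJE h.1, h.2⟩, h.1⟩⟩
    rw [h3] at h2
    simp only [one_mul, Finset.sum_const, nsmul_eq_mul, mul_one] at h2
    rw [Finset.sum_sub_distrib, h2]
    linarith
  have htot : ∑ e ∈ G.edgeFinset, (x e - if e ∈ J then 1 else 0) = 0 := by
    have h1 := hx.total
    rw [edgesInside_univ] at h1
    have h2 := hsumJ (fun _ => 1) G.edgeFinset
    rw [Finset.inter_eq_right.2 hJE] at h2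
    simp only [one_mul, Finset.sum_const, nsmul_eq_mul, mul_one] at h2
    rw [Finset.sum_sub_distrib, h1, h2, ← (isSpanningTree_iff.1 hJ).2.2]
    push_cast
    ring
  -- Any upper bound will do, since it gets multiplied by the total `0`.
  obtain ⟨M, hM⟩ : ∃ M, ∀ e ∈ G.edgeFinset, w e ≤ M := by
    obtain ⟨M, hM⟩ := (G.edgeFinset.image w).bddAbove
    exact ⟨M, fun e he => hM (Finset.mem_coe.2 (Finset.mem_image_of_mem w he))⟩
  have key := mul_sum_le_sum_mul_of_levels w _ _ hlev M hM
  rw [htot, mul_zero] at key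
  simp only [mul_sub, Finset.sum_sub_distrib] at key
  rw [hsumJ w, Finset.inter_eq_right.2 hJE] at key
  linarith

/-- **Edmonds**: a feasible vector is a convex combination of at most `|E| + 1` spanning trees. -/
theorem IsFeasible.exists_decomposition {G : SimpleGraph V} [DecidableRel G.Adj]
    (hG : G.Connected) {T : Finset V} {x : Sym2 V → ℝ} (hx : IsFeasible G T x) :
    ∃ (k : ℕ) (J : Fin k → Finset (Sym2 V)) (lam : Fin k → ℝ),
      k ≤ G.edgeFinset.card + 1 ∧ IsTreeDecomposition G x J lam := by
  classical
  set χ : Finset (Sym2 V) → (G.edgeFinset → ℝ) := fun J e => if (e : Sym2 V) ∈ J then 1 else 0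
    with hχ
  set 𝒯 : Set (Finset (Sym2 V)) := {J | IsSpanningTree G J} with h𝒯
  have hmem : (fun e : G.edgeFinset => x e) ∈ convexHull ℝ (χ '' 𝒯) := by
    by_contra hn
    -- A separating functional would be a weight for which `x` is lighter than every spanning tree.
    obtain ⟨f, u, h1, h2⟩ := geometric_hahn_banach_point_closed (convex_convexHull ℝ (χ '' 𝒯))
      (((Set.toFinite 𝒯).image χ).isClosed_convexHull ℝ) hn
    set w : Sym2 V → ℝ := fun e => if h : e ∈ G.edgeFinset then f (Pi.single ⟨e, h⟩ 1) else 0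
      with hw
    have hf : ∀ z : Sym2 V → ℝ,
        f (fun e : G.edgeFinset => z e) = ∑ e ∈ G.edgeFinset, w e * z e := by
      intro z
      have hz : (fun e : G.edgeFinset => z e) =
          ∑ e : G.edgeFinset, z e • (Pi.single e 1 : G.edgeFinset → ℝ) := by
        ext e
        simp [Finset.sum_apply, Pi.single_apply]
      rw [hz, map_sum, ← Finset.sum_coe_sort G.edgeFinset]
      refine Finset.sum_congr rfl fun e _ => ?_
      rw [map_smul, smul_eq_mul, mul_comm]
      simp only [hw, e.2, dif_pos]
    obtain ⟨J, hJ, hJw⟩ := hx.exists_tree_le hG w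
    have h3 := h2 (χ J) (subset_convexHull ℝ _ ⟨J, hJ, rfl⟩)
    have h4 : f (χ J) = ∑ e ∈ J, w e := by
      rw [hχ, hf fun e => if e ∈ J then 1 else 0]
      simp only [mul_ite, mul_one, mul_zero]
      rw [Finset.sum_ite_mem, Finset.inter_eq_right.2]
      exact fun e he => SimpleGraph.mem_edgeFinset.2 (hJ.1 e he)
    rw [hf] at h1
    linarith
  -- Carathéodory: the trees can be taken affinely independent in dimension `|E|`, which bounds
  -- their number.
  obtain ⟨ι, hι, z, w, hz, haff, hw0, hw1, hwx⟩ := eq_pos_convex_span_of_mem_convexHull hmem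
  choose J hJ hJz using fun i => hz (Set.mem_range_self i)
  set φ := (Fintype.equivFin ι).symm with hφ
  refine ⟨Fintype.card ι, J ∘ φ, w ∘ φ, ?_, fun i => hJ _, fun i => (hw0 _).le, ?_, fun e he => ?_⟩
  · have h1 := haff.card_le_finrank_succ
    have h2 := Submodule.finrank_le (vectorSpan ℝ (Set.range z))
    rw [Module.finrank_fintype_fun_eq_card, Fintype.card_coe] at h2
    omega
  · rw [← hw1]
    exact Equiv.sum_comp φ w
  · have h1 := congrFun hwx ⟨e, SimpleGraph.mem_edgeFinset.2 he⟩
    simp only [Finset.sum_apply, Pi.smul_apply, smul_eq_mul] at h1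
    rw [← h1]
    simp only [Function.comp_apply]
    rw [Equiv.sum_comp φ (fun i => w i * if e ∈ J i then 1 else 0)]
    refine Finset.sum_congr rfl fun i _ => ?_
    rw [← hJz i]

/-! ### Existence of an optimal solution -/

lemma edgesInside_subset {G : SimpleGraph V} [DecidableRel G.Adj] {S : Finset V} :
    edgesInside G S ⊆ G.edgeFinset := Finset.filter_subset _ _

lemma IsFeasible.congr {G : SimpleGraph V} [DecidableRel G.Adj] {T : Finset V}
    {x x' : Sym2 V → ℝ} (hx : IsFeasible G T x) (h : ∀ e ∈ G.edgeFinset, x' e = x e) :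
    IsFeasible G T x' where
  subtour S h1 h2 := by
    rw [Finset.sum_congr rfl fun e he => h e (edgesInside_subset he)]
    exact hx.subtour S h1 h2
  total := by
    rw [Finset.sum_congr rfl fun e he => h e (edgesInside_subset he)]
    exact hx.total
  even_cut S h1 h2 h3 := by
    rw [Finset.sum_congr rfl fun e he => h e (cut_subset he)]
    exact hx.even_cut S h1 h2 h3
  nonneg e he := by
    rw [h e he]
    exact hx.nonneg e he

lemma isClosed_isFeasible (G : SimpleGraph V) [DecidableRel G.Adj] (T : Finset V) :
    IsClosed {x : Sym2 V → ℝ | IsFeasible G T x} := by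
  have : {x : Sym2 V → ℝ | IsFeasible G T x} =
      (⋂ (S : Finset V) (_ : S ≠ Finset.univ) (_ : 2 ≤ S.card),
        {x | ∑ e ∈ edgesInside G S, x e ≤ (S.card : ℝ) - 1}) ∩
      {x | ∑ e ∈ edgesInside G Finset.univ, x e = (Fintype.card V : ℝ) - 1} ∩
      (⋂ (S : Finset V) (_ : S.Nonempty) (_ : S ≠ Finset.univ) (_ : Even (S ∩ T).card),
        {x | 2 ≤ ∑ e ∈ cut G S, x e}) ∩
      ⋂ (e : Sym2 V) (_ : e ∈ G.edgeFinset), {x | 0 ≤ x e} := by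
    ext x
    simp only [Set.mem_inter_iff, Set.mem_iInter]
    exact ⟨fun h => ⟨⟨⟨h.1, h.2⟩, h.3⟩, h.4⟩, fun h => ⟨h.1.1.1, h.1.1.2, h.1.2, h.2⟩⟩
  rw [this]
  refine IsClosed.inter (IsClosed.inter (IsClosed.inter ?_ ?_) ?_) ?_
  · refine isClosed_iInter fun S => isClosed_iInter fun _ => isClosed_iInter fun _ => ?_
    exact isClosed_le (by fun_prop) continuous_const
  · exact isClosed_eq (by fun_prop) continuous_const
  · refine isClosed_iInter fun S => isClosed_iInter fun _ => isClosed_iInter fun _ =>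
      isClosed_iInter fun _ => ?_
    exact isClosed_le continuous_const (by fun_prop)
  · refine isClosed_iInter fun e => isClosed_iInter fun _ => ?_
    exact isClosed_le continuous_const (by fun_prop)

lemma IsFeasible.le_one {G : SimpleGraph V} [DecidableRel G.Adj] {T : Finset V}
    {x : Sym2 V → ℝ} (hx : IsFeasible G T x) {e : Sym2 V} (he : e ∈ G.edgeFinset) : x e ≤ 1 := by
  induction e with | _ a b
  have hab : G.Adj a b := SimpleGraph.mem_edgeFinset.1 he
  have h1 := hx.sum_edgesInside_le (S := {a, b}) ⟨a, by simp⟩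
  have h2 : x s(a, b) ≤ ∑ e ∈ edgesInside G {a, b}, x e :=
    Finset.single_le_sum (fun e he => hx.nonneg e (Finset.filter_subset _ _ he))
      (mk_mem_edgesInside.2 ⟨hab, by simp, by simp⟩)
  rw [Finset.card_pair hab.ne] at h1
  push_cast at h1
  linarith

/-- A feasible linear program has an optimal solution. -/
theorem exists_isOptimal {G : SimpleGraph V} [DecidableRel G.Adj] (c : Sym2 V → ℝ) {T : Finset V}
    (h : ∃ x, IsFeasible G T x) : ∃ x, IsOptimal G c T x := by
  set K : Set (Sym2 V → ℝ) := Set.Icc 0 1 ∩ {x | IsFeasible G T x} with hK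
  have hKc : IsCompact K := isCompact_Icc.inter_right (isClosed_isFeasible G T)
  -- Values off the edges are unconstrained and cost nothing; set to zero, they leave the feasible
  -- vectors in a compact cube.
  have hnorm : ∀ x, IsFeasible G T x → ∃ x' ∈ K, lpCost G c x' = lpCost G c x := by
    intro x hx
    have hcongr : ∀ e ∈ G.edgeFinset, (if e ∈ G.edgeFinset then x e else 0) = x e :=
      fun e he => if_pos he
    refine ⟨fun e => if e ∈ G.edgeFinset then x e else 0, ⟨⟨fun e => ?_, fun e => ?_⟩,
      hx.congr hcongr⟩, Finset.sum_congr rfl fun e he => congrArg (c e * ·) (hcongr e he)⟩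
    · simp only [Pi.zero_apply]
      split_ifs with he
      · exact hx.nonneg e he
      · exact le_rfl
    · simp only [Pi.one_apply]
      split_ifs with he
      · exact hx.le_one he
      · exact zero_le_one
  obtain ⟨x₀, hx₀⟩ := h
  obtain ⟨x₁, hx₁, -⟩ := hnorm x₀ hx₀
  have hcont : Continuous (lpCost G c) := by
    unfold lpCost
    fun_prop
  obtain ⟨x, hx, hmin⟩ := hKc.exists_isMinOn ⟨x₁, hx₁⟩ hcont.continuousOn
  refine ⟨x, hx.2, fun x' hx' => ?_⟩
  obtain ⟨x'', hx'', heq⟩ := hnorm x' hx'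
  exact heq ▸ hmin hx''

/-! ### Feasibility on complete graphs -/

lemma sum_ite_mem_eq_card (A J : Finset (Sym2 V)) :
    ∑ e ∈ A, (if e ∈ J then (1 : ℝ) else 0) = (A ∩ J).card := by
  rw [Finset.sum_ite_mem]; simp

/-- Contract `S` to its node `s`: the tree edges not inside `S` still connect `|V| - |S| + 1` nodes,
so there are at least `|V| - |S|` of them. -/
lemma IsSpanningTree.card_inside_le {G : SimpleGraph V} [DecidableRel G.Adj]
    {J : Finset (Sym2 V)} (hJ : IsSpanningTree G J) {S : Finset V} (hS : S.Nonempty) :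
    (edgesInside G S ∩ J).card + 1 ≤ S.card := by
  obtain ⟨s, hs⟩ := hS
  have h1 := card_image_le_card_crossing hJ.2.connected (fun v => if v ∈ S then s else v)
  have h2 : (insert s Sᶜ).card ≤
      (Finset.univ.image fun v => if v ∈ S then s else v).card := by
    refine Finset.card_le_card fun v hv => ?_
    rw [Finset.mem_image]
    refine ⟨v, Finset.mem_univ _, ?_⟩
    rcases Finset.mem_insert.1 hv with rfl | hv
    · simp
    · simp [Finset.mem_compl.1 hv]
  rw [Finset.card_insert_of_notMem (by simpa using hs), Finset.card_compl] at h2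
  have h3 : (J.filter fun e => ¬ (e.map fun v => if v ∈ S then s else v).IsDiag).card ≤
      (J \ (edgesInside G S ∩ J)).card := by
    refine Finset.card_le_card fun e he => ?_
    rw [Finset.mem_filter] at he
    rw [Finset.mem_sdiff, Finset.mem_inter]
    refine ⟨he.1, fun h => he.2 ?_⟩
    induction e with | _ a b
    rw [mk_mem_edgesInside] at h
    simp [h.1.2.1, h.1.2.2]
  rw [Finset.card_sdiff_of_subset Finset.inter_subset_right] at h3
  have h4 := (isSpanningTree_iff.1 hJ).2.2
  have h5 := Finset.card_le_univ S
  have h6 : (edgesInside G S ∩ J).card ≤ J.card := Finset.card_le_card Finset.inter_subset_right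
  have h7 : 0 < S.card := Finset.card_pos.2 ⟨s, hs⟩
  omega

lemma IsSpanningTree.one_le_card_cut {G : SimpleGraph V} [DecidableRel G.Adj]
    {J : Finset (Sym2 V)} (hJ : IsSpanningTree G J) {S : Finset V} (hS : S.Nonempty)
    (hS' : S ≠ Finset.univ) : 1 ≤ (cut G S ∩ J).card := by
  have h1 := card_image_le_card_crossing hJ.2.connected (fun v => decide (v ∈ S))
  obtain ⟨s, hs⟩ := hS
  obtain ⟨t, ht⟩ : ∃ t, t ∉ S := by
    by_contra! h
    exact hS' (Finset.eq_univ_iff_forall.2 h)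
  have h2 : ({true, false} : Finset Bool).card ≤
      (Finset.univ.image fun v => decide (v ∈ S)).card := by
    refine Finset.card_le_card fun b hb => ?_
    rw [Finset.mem_image]
    rcases Finset.mem_insert.1 hb with rfl | hb
    · exact ⟨s, Finset.mem_univ _, by simpa using hs⟩
    · rw [Finset.mem_singleton] at hb
      subst hb
      exact ⟨t, Finset.mem_univ _, by simpa using ht⟩
  have h3 : (J.filter fun e => ¬ (e.map fun v => decide (v ∈ S)).IsDiag).card ≤
      (cut G S ∩ J).card := by
    refine Finset.card_le_card fun e he => ?_
    rw [Finset.mem_filter] at he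
    rw [Finset.mem_inter]
    refine ⟨?_, he.1⟩
    have heG := hJ.1 e he.1
    induction e with | _ a b
    refine mk_mem_cut.2 ⟨heG, ?_⟩
    have := he.2
    simp only [Sym2.map_mk, Sym2.mk_isDiag_iff, decide_eq_decide] at this
    tauto
  have h4 : ({true, false} : Finset Bool).card = 2 := rfl
  omega

/-- A spanning tree whose nodes of odd degree are those of `T` is feasible. -/
lemma IsSpanningTree.isFeasible {G : SimpleGraph V} [DecidableRel G.Adj] {T : Finset V}
    {J : Finset (Sym2 V)} (hJ : IsSpanningTree G J) (hT : bdry (chain J.val) = demand T) :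
    IsFeasible G T fun e => if e ∈ J then 1 else 0 where
  subtour S _ h2 := by
    rw [sum_ite_mem_eq_card, le_sub_iff_add_le]
    exact_mod_cast hJ.card_inside_le (Finset.card_pos.1 (by omega))
  total := by
    rw [sum_ite_mem_eq_card, edgesInside_univ, Finset.inter_eq_right.2 fun e he =>
      SimpleGraph.mem_edgeFinset.2 (hJ.1 e he), ← (isSpanningTree_iff.1 hJ).2.2]
    push_cast
    ring
  even_cut S h1 h2 h3 := by
    rw [sum_ite_mem_eq_card]
    have h4 := hJ.one_le_card_cut h1 h2
    -- No node has wrong degree, so the tree meets a `T`-even cut evenly, and therefore at least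
    -- twice.
    have h5 := sum_demand_wrongDegree (G := G) T hJ.1 S
    rw [demand_wrongDegree, hT, demand_add_self] at h5
    simp only [Pi.zero_apply, Finset.sum_const_zero, (ZMod.natCast_eq_zero_iff_even).2 h3,
      zero_add] at h5
    have h6 := (ZMod.natCast_eq_zero_iff_even).1 h5.symm
    have : 2 ≤ (cut G S ∩ J).card := by
      rcases h6 with ⟨r, hr⟩
      omega
    exact_mod_cast this
  nonneg e _ := by split_ifs <;> norm_num

lemma mem_chainSupport {f : Sym2 V → ZMod 2} {e : Sym2 V} : e ∈ chainSupport f ↔ f e ≠ 0 := by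
  simp [chainSupport]

/-- On every set `A ⊇ T` there is a tree whose nodes of odd degree are those of `T`. -/
lemma exists_tree_chain {T : Finset V} (hT : Even T.card) (hT2 : 2 ≤ T.card) (W : Finset V)
    (hW : Disjoint W T) :
    ∃ f : Sym2 V → ZMod 2, SuppOn ⊤ f ∧ bdry f = demand T ∧
      (chainSupport f).card + 1 ≤ (W ∪ T).card ∧ (∀ e, f e ≠ 0 → ∀ v ∈ e, v ∈ W ∪ T) ∧
      ∀ a ∈ W ∪ T, ∀ b ∈ W ∪ T,
        (SimpleGraph.fromEdgeSet (chainSupport f : Set (Sym2 V))).Reachable a b := by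
  classical
  induction W using Finset.induction_on with
  | empty =>
    -- A star on `T`: its leaves have degree one and its centre `r` has the odd degree `|T| - 1`.
    obtain ⟨r, hr⟩ : T.Nonempty := Finset.card_pos.1 (by omega)
    have hinj : Set.InjOn (fun t => s(r, t)) (T.erase r : Set V) := fun a _ b _ h =>
      Sym2.congr_right.1 h
    have hf : ∀ e, (∑ t ∈ T.erase r, (Pi.single s(r, t) 1 : Sym2 V → ZMod 2)) e =
        if e ∈ (T.erase r).image (fun t => s(r, t)) then 1 else 0 := by
      intro e
      rw [← Finset.sum_image (f := fun e' => (Pi.single e' 1 : Sym2 V → ZMod 2)) hinj]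
      simp [Finset.sum_apply, Pi.single_apply]
    set f : Sym2 V → ZMod 2 := ∑ t ∈ T.erase r, Pi.single s(r, t) 1 with hfdef
    have hsupp : chainSupport f = (T.erase r).image (fun t => s(r, t)) := by
      ext e
      rw [mem_chainSupport, hf]
      split_ifs with h <;> simp only [h, ne_eq, one_ne_zero, not_true, not_false_iff]
    have hmem : ∀ e, f e ≠ 0 → ∃ t ∈ T.erase r, s(r, t) = e := fun e he => by
      rw [← mem_chainSupport, hsupp] at he
      exact Finset.mem_image.1 he
    rw [Finset.empty_union]
    refine ⟨f, fun e he => ?_, ?_, ?_, ?_, ?_⟩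
    · by_contra hne
      obtain ⟨t, ht, rfl⟩ := hmem e hne
      exact he (Ne.symm (Finset.ne_of_mem_erase ht))
    · rw [hfdef, bdry_sum, Finset.sum_congr rfl fun t ht =>
        bdry_single (Finset.ne_of_mem_erase ht).symm, Finset.sum_add_distrib, Finset.sum_const,
        Finset.card_erase_of_mem hr]
      have hodd : ((T.card - 1 : ℕ) : ZMod 2) = 1 := by
        rw [ZMod.natCast_eq_one_iff_odd]
        rcases hT with ⟨k, hk⟩
        exact ⟨k - 1, by omega⟩
      rw [← Nat.cast_smul_eq_nsmul (ZMod 2), hodd, one_smul,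
        Finset.add_sum_erase T (fun t => (Pi.single t 1 : V → ZMod 2)) hr]
      ext v
      simp [demand, Finset.sum_apply, Pi.single_apply]
    · rw [hsupp]
      have h1 : ((T.erase r).image fun t => s(r, t)).card ≤ (T.erase r).card :=
        Finset.card_image_le
      rw [Finset.card_erase_of_mem hr] at h1
      omega
    · intro e he v hv
      obtain ⟨t, ht, rfl⟩ := hmem e he
      rcases Sym2.mem_iff.1 hv with rfl | rfl
      · exact hr
      · exact Finset.mem_of_mem_erase ht
    · have h0 : ∀ a ∈ T, (SimpleGraph.fromEdgeSet (chainSupport f : Set (Sym2 V))).Reachable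
          r a := by
        intro a ha
        by_cases har : a = r
        · rw [har]
        · refine SimpleGraph.Adj.reachable ?_
          rw [SimpleGraph.fromEdgeSet_adj, hsupp, Finset.mem_coe]
          exact ⟨Finset.mem_image_of_mem _ (Finset.mem_erase.2 ⟨har, ha⟩), Ne.symm har⟩
      exact fun a ha b hb => (h0 a ha).symm.trans (h0 b hb)
  | insert w W hw ih =>
    rw [Finset.disjoint_insert_left] at hW
    obtain ⟨f, hf, hfb, hfc, hfA, hfr⟩ := ih hW.2
    have hwA : w ∉ W ∪ T := by simp [hw, hW.1]
    obtain ⟨a₀, ha₀, b₀, hb₀, hne⟩ := Finset.one_lt_card.1 (show 1 < T.card by omega)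
    obtain ⟨e₀, he₀⟩ : ∃ e, f e ≠ 0 := by
      by_contra! h
      have h1 := congrFun hfb a₀
      simp [bdry, h, demand, ha₀] at h1
    induction e₀ with | _ a b
    have hab : a ≠ b := fun h => he₀ (hf _ (by simp [h]))
    have haA : a ∈ W ∪ T := hfA _ he₀ a (Sym2.mem_mk_left _ _)
    have hbA : b ∈ W ∪ T := hfA _ he₀ b (Sym2.mem_mk_right _ _)
    have haw : a ≠ w := fun h => hwA (h ▸ haA)
    have hbw : w ≠ b := fun h => hwA (h ▸ hbA)
    have hfw : ∀ v, f s(v, w) = 0 := fun v => by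
      by_contra h
      exact hwA (hfA _ h w (Sym2.mem_mk_right _ _))
    -- Adding the triangle on `a`, `b`, `w` mod 2 subdivides the tree edge `s(a, b)` by `w`, which
    -- changes no parity.
    set f' : Sym2 V → ZMod 2 :=
      f + (Pi.single s(a, b) 1 + (Pi.single s(a, w) 1 + Pi.single s(w, b) 1)) with hf'
    have h11 : (1 + 1 : ZMod 2) = 0 := rfl
    have hfab : f s(a, b) = 1 := zmod_two_eq_one he₀
    have hvab : f' s(a, b) = 0 := by
      simp [hf', hfab, h11, haw, hbw.symm, hab]
    have hvaw : f' s(a, w) ≠ 0 := by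
      simp [hf', hfw, haw, hbw, hab]
    have hvwb : f' s(w, b) ≠ 0 := by
      rw [Sym2.eq_swap]
      simp [hf', hfw, haw.symm, hbw, hbw.symm, Pi.single_apply, hab.symm]
    have hvother : ∀ e, e ≠ s(a, b) → e ≠ s(a, w) → e ≠ s(w, b) → f' e = f e := by
      intro e h1 h2 h3
      simp [hf', h1, h2, h3]
    have hsub : chainSupport f' ⊆ insert s(a, w) (insert s(w, b)
        ((chainSupport f).erase s(a, b))) := by
      intro e he
      rw [mem_chainSupport] at he
      simp only [Finset.mem_insert, Finset.mem_erase, mem_chainSupport]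
      by_cases h1 : e = s(a, b)
      · exact absurd (h1 ▸ hvab) he
      by_cases h2 : e = s(a, w)
      · exact Or.inl h2
      by_cases h3 : e = s(w, b)
      · exact Or.inr (Or.inl h3)
      exact Or.inr (Or.inr ⟨h1, hvother e h1 h2 h3 ▸ he⟩)
    refine ⟨f', ?_, ?_, ?_, ?_, ?_⟩
    · exact hf.add ((SuppOn.single hab).add ((SuppOn.single haw).add (SuppOn.single hbw)))
    · rw [hf', bdry_add, bdry_add, bdry_add, bdry_single hab, bdry_single haw, bdry_single hbw, hfb]
      calc _ = demand T + (Pi.single a 1 + Pi.single a 1) + (Pi.single b 1 + Pi.single b 1) +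
              (Pi.single w 1 + Pi.single w 1) := by abel
        _ = _ := by rw [demand_add_self, demand_add_self, demand_add_self, add_zero, add_zero,
                      add_zero]
    · have h1 := Finset.card_le_card hsub
      have h2 := Finset.card_insert_le s(a, w) (insert s(w, b) ((chainSupport f).erase s(a, b)))
      have h3 := Finset.card_insert_le s(w, b) ((chainSupport f).erase s(a, b))
      have h4 := Finset.card_erase_add_one (mem_chainSupport.2 he₀)
      rw [Finset.insert_union, Finset.card_insert_of_notMem hwA]
      omega
    · intro e he v hv
      rw [Finset.insert_union]
      have := hsub (mem_chainSupport.2 he)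
      simp only [Finset.mem_insert, Finset.mem_erase, mem_chainSupport] at this
      rcases this with rfl | rfl | h
      · rcases Sym2.mem_iff.1 hv with rfl | rfl
        · exact Finset.mem_insert_of_mem haA
        · exact Finset.mem_insert_self _ _
      · rcases Sym2.mem_iff.1 hv with rfl | rfl
        · exact Finset.mem_insert_self _ _
        · exact Finset.mem_insert_of_mem hbA
      · exact Finset.mem_insert_of_mem (hfA e h.2 v hv)
    · set H := SimpleGraph.fromEdgeSet (chainSupport f' : Set (Sym2 V)) with hH
      have hadj : ∀ p q, p ≠ q → f' s(p, q) ≠ 0 → H.Adj p q := fun p q h1 h2 => by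
        rw [hH, SimpleGraph.fromEdgeSet_adj]
        exact ⟨mem_chainSupport.2 h2, h1⟩
      have haw' := (hadj a w haw hvaw).reachable
      have hwb' := (hadj w b hbw hvwb).reachable
      have hmono : ∀ p q, (SimpleGraph.fromEdgeSet (chainSupport f : Set (Sym2 V))).Reachable p q →
          H.Reachable p q := by
        rintro p q ⟨u⟩
        induction u with
        | nil => exact SimpleGraph.Reachable.refl _
        | @cons p p' q hpp u ih =>
          refine SimpleGraph.Reachable.trans ?_ ih
          rw [SimpleGraph.fromEdgeSet_adj, Finset.mem_coe, mem_chainSupport] at hpp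
          by_cases h1 : s(p, p') = s(a, b)
          · rcases Sym2.eq_iff.1 h1 with ⟨rfl, rfl⟩ | ⟨rfl, rfl⟩
            · exact haw'.trans hwb'
            · exact (haw'.trans hwb').symm
          · refine (hadj p p' hpp.2 ?_).reachable
            rw [hvother _ h1]
            · exact hpp.1
            · intro h; rw [h] at hpp; exact hpp.1 (hfw a)
            · intro h; rw [h, Sym2.eq_swap] at hpp; exact hpp.1 (hfw b)
      have h0 : ∀ p ∈ insert w W ∪ T, H.Reachable a p := by
        intro p hp
        rw [Finset.insert_union, Finset.mem_insert] at hp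
        rcases hp with rfl | hp
        · exact haw'
        · exact hmono a p (hfr a haA p hp)
      exact fun p hp q hq => (h0 p hp).symm.trans (h0 q hq)

/-- On a complete graph the linear program is feasible. -/
theorem exists_isFeasible_top {G : SimpleGraph V} [DecidableRel G.Adj] (hG : G = ⊤)
    {T : Finset V} (hT : Even T.card) (hT2 : 2 ≤ T.card) : ∃ x, IsFeasible G T x := by
  obtain ⟨f, hf, hfb, hfc, -, hfr⟩ := exists_tree_chain hT hT2 Tᶜ disjoint_compl_left
  rw [← hG] at hf
  have huniv : Tᶜ ∪ T = Finset.univ := by ext; simp [em']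
  rw [huniv] at hfc hfr
  have : Nonempty V := by
    obtain ⟨r, -⟩ : T.Nonempty := Finset.card_pos.1 (by omega)
    exact ⟨r⟩
  have hconn : (SimpleGraph.fromEdgeSet (chainSupport f : Set (Sym2 V))).Connected :=
    ⟨fun a b => hfr a (Finset.mem_univ _) b (Finset.mem_univ _)⟩
  have htree : IsSpanningTree G (chainSupport f) := by
    refine isSpanningTree_iff.2 ⟨fun e he => ?_, hconn,
      le_antisymm hfc (card_le_card_add_one hconn)⟩
    by_contra h
    exact mem_chainSupport.1 he (hf e h)
  exact ⟨_, htree.isFeasible (by rw [chain_val_chainSupport, hfb])⟩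

/-! ### Narrow cuts and their representatives -/

/-- The value of a vector on a cut. -/
def cutValue (G : SimpleGraph V) [DecidableRel G.Adj] (x : Sym2 V → ℝ) (S : Finset V) : ℝ :=
  ∑ e ∈ cut G S, x e

lemma cutValue_eq_sum (G : SimpleGraph V) [DecidableRel G.Adj] (x : Sym2 V → ℝ) (S : Finset V) :
    cutValue G x S = ∑ e ∈ G.edgeFinset, if e ∈ cut G S then x e else 0 := by
  rw [cutValue, Finset.sum_ite_mem, Finset.inter_eq_right.2 cut_subset]

/-- Edge by edge: only edges between `A \ B` and `B \ A` are counted less often on the left. -/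
lemma cutValue_inter_add_union_le {G : SimpleGraph V} [DecidableRel G.Adj] {x : Sym2 V → ℝ}
    (hx : ∀ e ∈ G.edgeFinset, 0 ≤ x e) (A B : Finset V) :
    cutValue G x (A ∩ B) + cutValue G x (A ∪ B) ≤ cutValue G x A + cutValue G x B := by
  simp only [cutValue_eq_sum, ← Finset.sum_add_distrib]
  refine Finset.sum_le_sum fun e he => ?_
  have h := hx e he
  induction e with | _ a b
  have hab : G.Adj a b := SimpleGraph.mem_edgeFinset.1 he
  simp only [mk_mem_cut, hab, true_and, Finset.mem_inter, Finset.mem_union]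
  by_cases h1 : a ∈ A <;> by_cases h2 : a ∈ B <;> by_cases h3 : b ∈ A <;> by_cases h4 : b ∈ B <;>
    simp [h1, h2, h3, h4, h]

/-- Here only edges between `A ∩ B` and the complement of `A ∪ B` are lost. -/
lemma cutValue_sdiff_add_sdiff_le {G : SimpleGraph V} [DecidableRel G.Adj] {x : Sym2 V → ℝ}
    (hx : ∀ e ∈ G.edgeFinset, 0 ≤ x e) (A B : Finset V) :
    cutValue G x (A \ B) + cutValue G x (B \ A) ≤ cutValue G x A + cutValue G x B := by
  simp only [cutValue_eq_sum, ← Finset.sum_add_distrib]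
  refine Finset.sum_le_sum fun e he => ?_
  have h := hx e he
  induction e with | _ a b
  have hab : G.Adj a b := SimpleGraph.mem_edgeFinset.1 he
  simp only [mk_mem_cut, hab, true_and, Finset.mem_sdiff]
  by_cases h1 : a ∈ A <;> by_cases h2 : a ∈ B <;> by_cases h3 : b ∈ A <;> by_cases h4 : b ∈ B <;>
    simp [h1, h2, h3, h4, h]

/-- A `T`-odd set whose cut has value less than `3/2`. -/
def IsNarrow (G : SimpleGraph V) [DecidableRel G.Adj] (T : Finset V) (x : Sym2 V → ℝ)
    (S : Finset V) : Prop :=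
  Odd (S ∩ T).card ∧ cutValue G x S < 3 / 2

/-- Narrow sets that avoid a common node form a laminar family. -/
lemma IsFeasible.laminar {G : SimpleGraph V} [DecidableRel G.Adj] {T : Finset V}
    {x : Sym2 V → ℝ} (hx : IsFeasible G T x) {r : V} {A B : Finset V}
    (hA : IsNarrow G T x A) (hB : IsNarrow G T x B) (hrA : r ∉ A) (hrB : r ∉ B) :
    A ⊆ B ∨ B ⊆ A ∨ Disjoint A B := by
  have hne : ∀ S : Finset V, r ∉ S → S ≠ Finset.univ := fun S h1 h2 => h1 (by simp [h2])
  have h1 : (A ∩ T).card + (B ∩ T).card = ((A ∪ B) ∩ T).card + ((A ∩ B) ∩ T).card := by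
    rw [Finset.union_inter_distrib_right, Finset.inter_inter_distrib_right,
      Finset.card_union_add_card_inter]
  have h2 : ∀ A B : Finset V, ((A \ B) ∩ T).card + ((A ∩ B) ∩ T).card = (A ∩ T).card := by
    intro A B
    rw [← Finset.card_union_of_disjoint, ← Finset.union_inter_distrib_right,
      Finset.sdiff_union_inter]
    exact (Finset.disjoint_sdiff_inter A B).mono Finset.inter_subset_left Finset.inter_subset_left
  have hAo := hA.1
  have hBo := hB.1
  have hA2 := hA.2
  have hB2 := hB.2
  -- Either intersection and union or the two differences are `T`-even. Such a pair of nonempty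
  -- sets, proper because of `r`, would have cut values of sum at least 4, while `A` and `B` allow
  -- less than 3.
  rcases Nat.even_or_odd ((A ∩ B) ∩ T).card with he | ho
  · refine Or.inr (Or.inr ?_)
    rw [Finset.disjoint_iff_inter_eq_empty]
    by_contra hn
    have hn := Finset.nonempty_iff_ne_empty.2 hn
    have h3 := hx.even_cut (A ∩ B) hn (hne _ (by simp [hrA])) he
    have h4 := hx.even_cut (A ∪ B) (hn.mono (Finset.inter_subset_union))
      (hne _ (by simp [hrA, hrB])) (by
        rcases hAo with ⟨p, hp⟩; rcases hBo with ⟨q, hq⟩; rcases he with ⟨s, hs⟩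
        exact ⟨p + q + 1 - s, by omega⟩)
    have h5 := cutValue_inter_add_union_le hx.nonneg A B
    unfold cutValue at h5 hA2 hB2
    linarith
  · by_contra! hn
    obtain ⟨hn1, hn2, -⟩ := hn
    have h3 := hx.even_cut (A \ B) (Finset.sdiff_nonempty.2 hn1) (hne _ (by simp [hrA])) (by
      have := h2 A B
      rcases hAo with ⟨p, hp⟩; rcases ho with ⟨s, hs⟩
      exact ⟨p - s, by omega⟩)
    have h4 := hx.even_cut (B \ A) (Finset.sdiff_nonempty.2 hn2) (hne _ (by simp [hrB])) (by
      have := h2 B A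
      rw [Finset.inter_comm B A] at this
      rcases hBo with ⟨p, hp⟩; rcases ho with ⟨s, hs⟩
      exact ⟨p - s, by omega⟩)
    have h5 := cutValue_sdiff_add_sdiff_le hx.nonneg A B
    unfold cutValue at h5 hA2 hB2
    linarith

/-- The edges of a spanning tree in the cuts of a family connect the classes of the family. -/
lemma IsSpanningTree.card_classes_le {G : SimpleGraph V} [DecidableRel G.Adj]
    {J : Finset (Sym2 V)} (hJ : IsSpanningTree G J) (𝓕 : Finset (Finset V)) :
    (Finset.univ.image fun v => 𝓕.filter (v ∈ ·)).card ≤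
      (J.filter fun e => ∃ A ∈ 𝓕, e ∈ cut G A).card + 1 := by
  refine (card_image_le_card_crossing hJ.2.connected _).trans ?_
  gcongr with e he
  intro h
  have heG := hJ.1 e he
  induction e with | _ a b
  simp only [Sym2.map_mk, Sym2.mk_isDiag_iff] at h
  by_contra! hn
  refine h (Finset.filter_congr fun A hA => ?_)
  have := hn A hA
  rw [mk_mem_cut] at this
  have hab : G.Adj a b := heG
  tauto

/-- The value of a cut in terms of a tree decomposition. -/
lemma IsTreeDecomposition.cutValue_eq {G : SimpleGraph V} [DecidableRel G.Adj]
    {x : Sym2 V → ℝ} {k : ℕ} {J : Fin k → Finset (Sym2 V)} {lam : Fin k → ℝ}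
    (h : IsTreeDecomposition G x J lam) (S : Finset V) :
    cutValue G x S = ∑ i, lam i * (cut G S ∩ J i).card := by
  rw [cutValue, Finset.sum_congr rfl fun e he =>
    h.combination e (SimpleGraph.mem_edgeFinset.1 (cut_subset he)), Finset.sum_comm]
  refine Finset.sum_congr rfl fun i _ => ?_
  rw [← Finset.mul_sum, sum_ite_mem_eq_card]

/-- A narrow set is not the disjoint union of smaller narrow sets. -/
lemma IsTreeDecomposition.biUnion_ne {G : SimpleGraph V} [DecidableRel G.Adj] {T : Finset V}
    {x : Sym2 V → ℝ} {k : ℕ} {J : Fin k → Finset (Sym2 V)} {lam : Fin k → ℝ}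
    (h : IsTreeDecomposition G x J lam) {r : V} {U : Finset V} (hrU : r ∉ U)
    (hU : IsNarrow G T x U) {𝓒 : Finset (Finset V)} (h𝓒 : ∀ A ∈ 𝓒, IsNarrow G T x A ∧ A ⊂ U)
    (hdisj : ∀ A ∈ 𝓒, ∀ B ∈ 𝓒, A ≠ B → Disjoint A B) : 𝓒.biUnion id ≠ U := by
  intro hun
  have hU𝓒 : U ∉ 𝓒 := fun hU' => (h𝓒 U hU').2.ne rfl
  have hnonempty : ∀ A ∈ 𝓒, A.Nonempty := fun A hA => by
    by_contra hn
    rw [Finset.not_nonempty_iff_eq_empty] at hn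
    subst hn
    have := (h𝓒 _ hA).1.1
    simp at this
  have hcover : ∀ v ∈ U, ∃ A ∈ 𝓒, v ∈ A := fun v hv => by
    rw [← hun, Finset.mem_biUnion] at hv
    exact hv
  -- parity
  have hpar : Odd 𝓒.card := by
    have h1 : (U ∩ T).card = ∑ A ∈ 𝓒, (A ∩ T).card := by
      rw [← hun, Finset.biUnion_inter, Finset.card_biUnion]
      · rfl
      · intro A hA B hB hAB
        exact (hdisj A hA B hB hAB).mono Finset.inter_subset_left Finset.inter_subset_left
    have h2 : ((U ∩ T).card : ZMod 2) = 1 := ZMod.natCast_eq_one_iff_odd.2 hU.1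
    rw [h1, Nat.cast_sum, Finset.sum_congr rfl fun A hA =>
      ZMod.natCast_eq_one_iff_odd.2 (h𝓒 A hA).1.1, Finset.sum_const, nsmul_one] at h2
    exact ZMod.natCast_eq_one_iff_odd.1 h2
  have hne1 : 𝓒.card ≠ 1 := by
    intro h1
    obtain ⟨A, rfl⟩ := Finset.card_eq_one.1 h1
    rw [Finset.singleton_biUnion] at hun
    exact (h𝓒 A (by simp)).2.ne hun
  -- every tree has at least `2 |𝓒|` edges in the cuts, counted with multiplicity
  have htree : ∀ i, 2 * 𝓒.card ≤ ∑ A ∈ insert U 𝓒, (cut G A ∩ J i).card := by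
    intro i
    have h1 := (h.spanning i).card_classes_le 𝓒
    -- The classes include one for each member of `𝓒`, and `∅` for the node `r`.
    have h2 : (insert ∅ (𝓒.image fun A => ({A} : Finset (Finset V)))).card ≤
        (Finset.univ.image fun v => 𝓒.filter (v ∈ ·)).card := by
      refine Finset.card_le_card fun X hX => ?_
      rw [Finset.mem_image]
      rcases Finset.mem_insert.1 hX with rfl | hX
      · refine ⟨r, Finset.mem_univ _, Finset.filter_eq_empty_iff.2 fun A hA hr => ?_⟩
        exact hrU ((h𝓒 A hA).2.subset hr)
      · obtain ⟨A, hA, rfl⟩ := Finset.mem_image.1 hX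
        obtain ⟨v, hv⟩ := hnonempty A hA
        refine ⟨v, Finset.mem_univ _, ?_⟩
        ext B
        rw [Finset.mem_filter, Finset.mem_singleton]
        refine ⟨fun hB => ?_, fun hB => hB ▸ ⟨hA, hv⟩⟩
        by_contra hne
        exact Finset.disjoint_left.1 (hdisj B hB.1 A hA hne) hB.2 hv
    rw [Finset.card_insert_of_notMem (by simp),
      Finset.card_image_of_injective _ Finset.singleton_injective] at h2
    have h3 : ∑ A ∈ insert U 𝓒, (cut G A ∩ J i).card =
        ∑ e ∈ J i, ((insert U 𝓒).filter (e ∈ cut G ·)).card := by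
      have : ∀ A, (cut G A ∩ J i).card = ∑ e ∈ J i, if e ∈ cut G A then 1 else 0 := fun A => by
        rw [Finset.inter_comm, ← Finset.filter_mem_eq_inter, Finset.card_filter]
      simp_rw [this, Finset.card_filter]
      exact Finset.sum_comm
    -- An edge leaving a member of `𝓒` enters another member or leaves `U`, so it lies in two of the
    -- cuts.
    have h4 : ∑ e ∈ (J i).filter (fun e => ∃ A ∈ 𝓒, e ∈ cut G A), 2 ≤
        ∑ e ∈ J i, ((insert U 𝓒).filter (e ∈ cut G ·)).card := by
      refine (Finset.sum_le_sum fun e he => ?_).trans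
        (Finset.sum_le_sum_of_subset (Finset.filter_subset _ _))
      obtain ⟨-, A, hA, heA⟩ := Finset.mem_filter.1 he
      obtain ⟨a, ha, b, hb, rfl⟩ := (Finset.mem_filter.1 heA).2
      rw [Finset.mem_compl] at hb
      have hab : G.Adj a b := (mk_mem_cut.1 heA).1
      refine Finset.one_lt_card.2 ?_
      by_cases hbU : b ∈ U
      · obtain ⟨B, hB, hbB⟩ := hcover b hbU
        have hAB : A ≠ B := fun h => hb (h ▸ hbB)
        refine ⟨A, ?_, B, ?_, hAB⟩
        · exact Finset.mem_filter.2 ⟨Finset.mem_insert_of_mem hA, heA⟩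
        · refine Finset.mem_filter.2 ⟨Finset.mem_insert_of_mem hB,
            mk_mem_cut.2 ⟨hab, Or.inr ⟨?_, hbB⟩⟩⟩
          exact Finset.disjoint_left.1 (hdisj A hA B hB hAB) ha
      · refine ⟨A, ?_, U, ?_, fun h => hU𝓒 (h ▸ hA)⟩
        · exact Finset.mem_filter.2 ⟨Finset.mem_insert_of_mem hA, heA⟩
        · exact Finset.mem_filter.2 ⟨Finset.mem_insert_self _ _,
            mk_mem_cut.2 ⟨hab, Or.inl ⟨(h𝓒 A hA).2.subset ha, hbU⟩⟩⟩
    rw [Finset.sum_const, smul_eq_mul] at h4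
    rw [h3]
    omega
  have hsum : (2 * 𝓒.card : ℝ) ≤ ∑ A ∈ insert U 𝓒, cutValue G x A := by
    simp_rw [h.cutValue_eq]
    rw [Finset.sum_comm]
    calc (2 * 𝓒.card : ℝ) = ∑ i, lam i * (2 * 𝓒.card) := by
          rw [← Finset.sum_mul, h.sum_eq_one, one_mul]
      _ ≤ ∑ i, lam i * ∑ A ∈ insert U 𝓒, ((cut G A ∩ J i).card : ℝ) := by
          refine Finset.sum_le_sum fun i _ => mul_le_mul_of_nonneg_left ?_ (h.nonneg i)
          exact_mod_cast htree i
      _ = _ := by simp_rw [Finset.mul_sum]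
  have hlt : ∑ A ∈ insert U 𝓒, cutValue G x A < ∑ A ∈ insert U 𝓒, (3 / 2 : ℝ) := by
    refine Finset.sum_lt_sum_of_nonempty ⟨U, Finset.mem_insert_self _ _⟩ fun A hA => ?_
    rcases Finset.mem_insert.1 hA with rfl | hA
    · exact hU.2
    · exact (h𝓒 A hA).1.2
  rw [Finset.sum_const, Finset.card_insert_of_notMem hU𝓒, nsmul_eq_mul] at hlt
  push_cast at hlt
  -- From `2 * |𝓒| < 3/2 * (|𝓒| + 1)`; but `|𝓒|` is odd and not 1.
  have h3 : (𝓒.card : ℝ) < 3 := by linarith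
  have h4 : 𝓒.card < 3 := by exact_mod_cast h3
  rcases hpar with ⟨s, hs⟩
  omega

/-- Every member of a family of narrow sets has a node that is in no smaller member. -/
lemma IsTreeDecomposition.exists_private {G : SimpleGraph V} [DecidableRel G.Adj] {T : Finset V}
    {x : Sym2 V → ℝ} (hx : IsFeasible G T x) {k : ℕ} {J : Fin k → Finset (Sym2 V)}
    {lam : Fin k → ℝ} (h : IsTreeDecomposition G x J lam) {r : V} {𝓕 : Finset (Finset V)}
    (h𝓕 : ∀ A ∈ 𝓕, IsNarrow G T x A ∧ r ∉ A) {U : Finset V} (hU : U ∈ 𝓕) :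
    ∃ v ∈ U, ∀ A ∈ 𝓕, A ⊂ U → v ∉ A := by
  classical
  by_contra! hn
  set 𝓢 := 𝓕.filter (· ⊂ U) with h𝓢
  -- If smaller members covered `U`, the maximal ones among them would partition `U` by laminarity.
  set 𝓒 := 𝓢.filter (fun A => Maximal (· ∈ 𝓢) A) with h𝓒
  have hmem : ∀ A ∈ 𝓒, A ∈ 𝓕 ∧ A ⊂ U ∧ Maximal (· ∈ 𝓢) A := fun A hA => by
    rw [h𝓒, Finset.mem_filter, h𝓢, Finset.mem_filter] at hA
    exact ⟨hA.1.1, hA.1.2, hA.2⟩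
  refine h.biUnion_ne (h𝓕 U hU).2 (h𝓕 U hU).1 (𝓒 := 𝓒)
    (fun A hA => ⟨(h𝓕 A (hmem A hA).1).1, (hmem A hA).2.1⟩) ?_ ?_
  · intro A hA B hB hAB
    obtain ⟨hA1, -, hA2⟩ := hmem A hA
    obtain ⟨hB1, -, hB2⟩ := hmem B hB
    rcases hx.laminar (h𝓕 A hA1).1 (h𝓕 B hB1).1 (h𝓕 A hA1).2 (h𝓕 B hB1).2 with h1 | h1 | h1
    · exact absurd (hA2.eq_of_le hB2.1 h1) hAB
    · exact absurd (hB2.eq_of_le hA2.1 h1).symm hAB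
    · exact h1
  · refine Finset.Subset.antisymm (Finset.biUnion_subset.2 fun A hA => (hmem A hA).2.1.subset) ?_
    intro v hv
    obtain ⟨A, hA, hAU, hvA⟩ := hn v hv
    obtain ⟨B, hAB, hB⟩ := 𝓢.exists_le_maximal (Finset.mem_filter.2 ⟨hA, hAU⟩)
    exact Finset.mem_biUnion.2 ⟨B, Finset.mem_filter.2 ⟨hB.1, hB⟩, hAB hvA⟩

/-- The cuts of the narrow sets that avoid `r` have a system of distinct representatives in every
tree. -/
lemma IsTreeDecomposition.exists_representatives {G : SimpleGraph V} [DecidableRel G.Adj]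
    {T : Finset V} {x : Sym2 V → ℝ} (hx : IsFeasible G T x) {k : ℕ}
    {J : Fin k → Finset (Sym2 V)} {lam : Fin k → ℝ} (h : IsTreeDecomposition G x J lam) {r : V}
    {𝓝 : Finset (Finset V)} (h𝓝 : ∀ A ∈ 𝓝, IsNarrow G T x A ∧ r ∉ A) (i : Fin k) :
    ∃ φ : Finset V → Sym2 V, Set.InjOn φ 𝓝 ∧ ∀ U ∈ 𝓝, φ U ∈ cut G U ∩ J i := by
  classical
  -- Hall's condition. Private nodes of the members of `s` lie in pairwise different, nonempty
  -- subfamilies, and `r` lies in no member. The tree connects these `|s| + 1` classes and needs at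
  -- least `|s|` edges of the cuts for it.
  have hall : ∀ s : Finset 𝓝, s.card ≤ (s.biUnion fun U => cut G (U : Finset V) ∩ J i).card := by
    intro s
    set 𝓕 : Finset (Finset V) := s.map (Function.Embedding.subtype _) with h𝓕
    have hmem : ∀ A ∈ 𝓕, IsNarrow G T x A ∧ r ∉ A := by
      intro A hA
      obtain ⟨A', -, rfl⟩ := Finset.mem_map.1 hA
      exact h𝓝 _ A'.2
    have hpriv : ∀ U : Finset V, ∃ v, U ∈ 𝓕 → v ∈ U ∧ ∀ A ∈ 𝓕, A ⊂ U → v ∉ A := by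
      intro U
      by_cases hU : U ∈ 𝓕
      · obtain ⟨v, h1, h2⟩ := h.exists_private hx hmem hU
        exact ⟨v, fun _ => ⟨h1, h2⟩⟩
      · exact ⟨r, fun h => absurd h hU⟩
    choose v hv using hpriv
    have hinj : Set.InjOn (fun U => 𝓕.filter (v U ∈ ·)) 𝓕 := by
      intro A hA B hB hAB
      have hA := Finset.mem_coe.1 hA
      have hB := Finset.mem_coe.1 hB
      have h1 : v A ∈ B := by
        by_contra hn
        have : B ∈ 𝓕.filter (v B ∈ ·) := Finset.mem_filter.2 ⟨hB, (hv B hB).1⟩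
        rw [← show 𝓕.filter (v A ∈ ·) = 𝓕.filter (v B ∈ ·) from hAB] at this
        exact hn (Finset.mem_filter.1 this).2
      have h2 : v B ∈ A := by
        by_contra hn
        have : A ∈ 𝓕.filter (v A ∈ ·) := Finset.mem_filter.2 ⟨hA, (hv A hA).1⟩
        rw [show 𝓕.filter (v A ∈ ·) = 𝓕.filter (v B ∈ ·) from hAB] at this
        exact hn (Finset.mem_filter.1 this).2
      by_contra hne
      rcases hx.laminar (hmem A hA).1 (hmem B hB).1 (hmem A hA).2 (hmem B hB).2 with h3 | h3 | h3
      · exact (hv B hB).2 A hA (h3.ssubset_of_ne hne) h2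
      · exact (hv A hA).2 B hB (h3.ssubset_of_ne (Ne.symm hne)) h1
      · exact Finset.disjoint_left.1 h3 (hv A hA).1 h1
    have h1 := (h.spanning i).card_classes_le 𝓕
    have h2 : (insert ∅ (𝓕.image fun U => 𝓕.filter (v U ∈ ·))).card ≤
        (Finset.univ.image fun v => 𝓕.filter (v ∈ ·)).card := by
      refine Finset.card_le_card fun X hX => ?_
      rw [Finset.mem_image]
      rcases Finset.mem_insert.1 hX with rfl | hX
      · exact ⟨r, Finset.mem_univ _, Finset.filter_eq_empty_iff.2 fun A hA => (hmem A hA).2⟩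
      · obtain ⟨A, hA, rfl⟩ := Finset.mem_image.1 hX
        exact ⟨v A, Finset.mem_univ _, rfl⟩
    rw [Finset.card_insert_of_notMem, Finset.card_image_of_injOn hinj] at h2
    · have h3 : ((J i).filter fun e => ∃ A ∈ 𝓕, e ∈ cut G A).card ≤
          (s.biUnion fun U => cut G (U : Finset V) ∩ J i).card := by
        refine Finset.card_le_card fun e he => ?_
        obtain ⟨heJ, A, hA, heA⟩ := Finset.mem_filter.1 he
        obtain ⟨A', hA', rfl⟩ := Finset.mem_map.1 hA
        exact Finset.mem_biUnion.2 ⟨A', hA', Finset.mem_inter.2 ⟨heA, heJ⟩⟩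
      have h4 : 𝓕.card = s.card := Finset.card_map _
      omega
    · intro h0
      obtain ⟨A, hA, hA0⟩ := Finset.mem_image.1 h0
      exact Finset.filter_eq_empty_iff.1 hA0 hA (hv A hA).1
  obtain ⟨f, hf, hfm⟩ := (Finset.all_card_le_biUnion_card_iff_exists_injective _).1 hall
  refine ⟨fun U => if hU : U ∈ 𝓝 then f ⟨U, hU⟩ else s(r, r), fun A hA B hB hAB => ?_,
    fun U hU => ?_⟩
  · have hA := Finset.mem_coe.1 hA
    have hB := Finset.mem_coe.1 hB
    simp only [hA, hB, dif_pos] at hAB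
    exact congrArg Subtype.val (hf hAB)
  · simp only [hU, dif_pos]
    exact hfm ⟨U, hU⟩

lemma cutValue_compl (G : SimpleGraph V) [DecidableRel G.Adj] (x : Sym2 V → ℝ) (S : Finset V) :
    cutValue G x Sᶜ = cutValue G x S := by
  rw [cutValue, cut_compl, cutValue]

/-- Every narrow cut can thus be represented by its side avoiding `r`. -/
lemma isNarrow_compl {G : SimpleGraph V} [DecidableRel G.Adj] {T : Finset V} (hT : Even T.card)
    {x : Sym2 V → ℝ} {S : Finset V} (hS : IsNarrow G T x S) : IsNarrow G T x Sᶜ := by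
  refine ⟨?_, by rw [cutValue_compl]; exact hS.2⟩
  have h1 : (S ∩ T).card + (Sᶜ ∩ T).card = T.card := by
    rw [← Finset.card_union_of_disjoint, ← Finset.union_inter_distrib_right,
      Finset.union_compl, Finset.univ_inter]
    exact disjoint_compl_right.mono Finset.inter_subset_left Finset.inter_subset_left
  have h2 := hS.1
  rcases h2 with ⟨p, hp⟩
  rcases hT with ⟨q, hq⟩
  exact ⟨q - p - 1, by omega⟩

/-! ### The covering vector and its expected cost -/

/-- The vector that dominates a convex combination of joins of the wrong-degree nodes of `J`: a
combination of the tree, the optimal solution `x` and corrections `f U` of the deficient narrow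
cuts. -/
noncomputable def joinVector (G : SimpleGraph V) [DecidableRel G.Adj] (x : Sym2 V → ℝ)
    (𝓝 : Finset (Finset V)) (f : Finset V → Sym2 V → ℝ) (J : Finset (Sym2 V)) (e : Sym2 V) : ℝ :=
  1 / 5 * (if e ∈ J then 1 else 0) + 2 / 5 * x e +
    ∑ U ∈ 𝓝, (if Even (cut G U ∩ J).card then 1 else 0) *
      (2 / 5 * (3 / 2 - cutValue G x U) * f U e)

/-- Serves twice: with `c = 1` on a cut for the covering property, and on all edges for the cost. -/
lemma sum_mul_joinVector (G : SimpleGraph V) [DecidableRel G.Adj] (x c : Sym2 V → ℝ)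
    (𝓝 : Finset (Finset V)) (f : Finset V → Sym2 V → ℝ) (J A : Finset (Sym2 V)) :
    ∑ e ∈ A, c e * joinVector G x 𝓝 f J e =
      1 / 5 * ∑ e ∈ A ∩ J, c e + 2 / 5 * ∑ e ∈ A, c e * x e +
        ∑ U ∈ 𝓝, (if Even (cut G U ∩ J).card then 1 else 0) *
          (2 / 5 * (3 / 2 - cutValue G x U) * ∑ e ∈ A, c e * f U e) := by
  simp only [joinVector, mul_add, Finset.sum_add_distrib]
  congr 1
  · congr 1
    · rw [Finset.mul_sum, ← Finset.sum_ite_mem]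
      exact Finset.sum_congr rfl fun e _ => by split_ifs <;> ring
    · rw [Finset.mul_sum]
      exact Finset.sum_congr rfl fun e _ => by ring
  · simp_rw [Finset.mul_sum]
    rw [Finset.sum_comm]
    exact Finset.sum_congr rfl fun U _ => Finset.sum_congr rfl fun e _ => by ring

/-- `joinVector` covers the cuts that are odd with respect to the wrong-degree nodes. -/
lemma one_le_sum_cut_joinVector {G : SimpleGraph V} [DecidableRel G.Adj] {T : Finset V}
    (hT : Even T.card) {x : Sym2 V → ℝ} (hx : IsFeasible G T x) {J : Finset (Sym2 V)}
    (hJ : IsSpanningTree G J) {r : V} {𝓝 : Finset (Finset V)}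
    (h𝓝 : ∀ U, U ∈ 𝓝 ↔ IsNarrow G T x U ∧ r ∉ U) {f : Finset V → Sym2 V → ℝ}
    (hf0 : ∀ U e, 0 ≤ f U e) (hf1 : ∀ U ∈ 𝓝, ∑ e ∈ cut G U, f U e = 1) {S : Finset V}
    (hS : ∑ v ∈ S, demand (wrongDegree T J) v = 1) :
    1 ≤ ∑ e ∈ cut G S, joinVector G x 𝓝 f J e := by
  have hS1 : S.Nonempty := by
    by_contra hn
    rw [Finset.not_nonempty_iff_eq_empty] at hn
    subst hn
    simp at hS
  have hS2 : S ≠ Finset.univ := by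
    rintro rfl
    rw [sum_demand_wrongDegree_univ hT hJ.1] at hS
    exact absurd hS (by decide)
  rw [sum_demand_wrongDegree T hJ.1] at hS
  have hcut := hJ.one_le_card_cut hS1 hS2
  have hsum := sum_mul_joinVector G x (fun _ => 1) 𝓝 f J (cut G S)
  simp only [one_mul, Finset.sum_const, nsmul_eq_mul, mul_one] at hsum
  rw [hsum]
  have hterm : ∀ U ∈ 𝓝, 0 ≤ (if Even (cut G U ∩ J).card then (1 : ℝ) else 0) *
      (2 / 5 * (3 / 2 - cutValue G x U) * ∑ e ∈ cut G S, f U e) := by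
    intro U hU
    have h1 := ((h𝓝 U).1 hU).1.2
    have h2 : 0 ≤ ∑ e ∈ cut G S, f U e := Finset.sum_nonneg fun e _ => hf0 U e
    refine mul_nonneg (by split_ifs <;> norm_num) (mul_nonneg (by linarith) h2)
  have hterms := Finset.sum_nonneg hterm
  -- For a `T`-even set, tree and `x` alone give `1/5 * 1 + 2/5 * 2 = 1`.
  rcases Nat.even_or_odd (S ∩ T).card with he | ho
  · have h1 := hx.even_cut S hS1 hS2 he
    have h2 : (1 : ℝ) ≤ (cut G S ∩ J).card := by exact_mod_cast hcut
    linarith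
  · have heven : Even (cut G S ∩ J).card := by
      rw [ZMod.natCast_eq_one_iff_odd.2 ho] at hS
      rw [← ZMod.natCast_eq_zero_iff_even]
      exact add_eq_left.1 hS
    have h2 : (2 : ℝ) ≤ (cut G S ∩ J).card := by
      have : 2 ≤ (cut G S ∩ J).card := by
        rcases heven with ⟨s, hs⟩
        omega
      exact_mod_cast this
    -- Tree and `x` give at least `2/5 + 2/5 * cutValue G x S`, which reaches 1 at `3/2`; below that
    -- the correction of this cut supplies the difference.
    by_cases hn : cutValue G x S < 3 / 2
    · have hnar : IsNarrow G T x S := ⟨ho, hn⟩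
      obtain ⟨U, hU, hUS⟩ : ∃ U ∈ 𝓝, cut G U = cut G S := by
        by_cases hr : r ∈ S
        · exact ⟨Sᶜ, (h𝓝 _).2 ⟨isNarrow_compl hT hnar, by simpa using hr⟩, cut_compl S⟩
        · exact ⟨S, (h𝓝 _).2 ⟨hnar, hr⟩, rfl⟩
      have h3 := Finset.single_le_sum hterm hU
      have h4 := hf1 U hU
      rw [cutValue, hUS] at h3
      rw [hUS] at h4
      rw [if_pos heven, h4] at h3
      linarith
    · unfold cutValue at hn
      linarith

/-- The expected cost of the joins. -/
lemma IsTreeDecomposition.sum_cost_join_le {G : SimpleGraph V} [DecidableRel G.Adj]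
    (hG : G.Connected) {c : Sym2 V → ℝ} (hc : ∀ e ∈ G.edgeSet, 0 ≤ c e) {T : Finset V}
    (hT : Even T.card) {x : Sym2 V → ℝ} (hx : IsFeasible G T x) {k : ℕ}
    {J : Fin k → Finset (Sym2 V)} {lam : Fin k → ℝ} (h : IsTreeDecomposition G x J lam)
    {M : Fin k → Multiset (Sym2 V)}
    (hM : ∀ i, IsMinCostJoin G c (wrongDegree T (J i)) (M i))
    (hcost : ∑ i, lam i * ∑ e ∈ J i, c e = lpCost G c x) :
    ∑ i, lam i * cost c (M i) ≤ 5 / 8 * lpCost G c x := by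
  classical
  obtain ⟨r⟩ := hG.nonempty
  set 𝓝 : Finset (Finset V) := Finset.univ.filter fun U => IsNarrow G T x U ∧ r ∉ U with h𝓝def
  have h𝓝 : ∀ U, U ∈ 𝓝 ↔ IsNarrow G T x U ∧ r ∉ U := fun U => by simp [h𝓝def]
  choose φ hφi hφm using h.exists_representatives hx (r := r) (𝓝 := 𝓝) fun A hA => (h𝓝 A).1 hA
  -- The representatives of `U` are averaged over all trees, so `f U` does not depend on the tree
  -- being corrected.
  set f : Finset V → Sym2 V → ℝ := fun U e => ∑ j, lam j * (if φ j U = e then 1 else 0) with hf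
  have hJE : ∀ i, J i ⊆ G.edgeFinset := fun i e he =>
    SimpleGraph.mem_edgeFinset.2 ((h.spanning i).1 e he)
  have hf0 : ∀ U e, 0 ≤ f U e := fun U e =>
    Finset.sum_nonneg fun j _ => mul_nonneg (h.nonneg j) (by split_ifs <;> norm_num)
  have hfsum : ∀ (U : Finset V) (A : Finset (Sym2 V)) (w : Sym2 V → ℝ), (∀ j, φ j U ∈ A) →
      ∑ e ∈ A, w e * f U e = ∑ j, lam j * w (φ j U) := by
    intro U A w hA
    simp only [hf, Finset.mul_sum]
    rw [Finset.sum_comm]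
    refine Finset.sum_congr rfl fun j _ => ?_
    rw [Finset.sum_eq_single_of_mem _ (hA j) fun e _ he => by rw [if_neg he.symm]; ring]
    rw [if_pos rfl]
    ring
  have hf1 : ∀ U ∈ 𝓝, ∑ e ∈ cut G U, f U e = 1 := by
    intro U hU
    have := hfsum U (cut G U) (fun _ => 1) fun j => (Finset.mem_inter.1 (hφm j U hU)).1
    simpa [h.sum_eq_one] using this
  set C : Finset V → ℝ := fun U => ∑ j, lam j * c (φ j U) with hC
  have hCsum : ∀ U ∈ 𝓝, ∑ e ∈ G.edgeFinset, c e * f U e = C U := fun U hU =>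
    hfsum U _ c fun j => hJE j (Finset.mem_inter.1 (hφm j U hU)).2
  have hC0 : ∀ U ∈ 𝓝, 0 ≤ C U := fun U hU => Finset.sum_nonneg fun j _ =>
    mul_nonneg (h.nonneg j) (hc _ ((h.spanning j).1 _ (Finset.mem_inter.1 (hφm j U hU)).2))
  -- Within each tree the representatives are distinct edges, so together they cost at most the
  -- tree.
  have hCtot : ∑ U ∈ 𝓝, C U ≤ lpCost G c x := by
    rw [← hcost, hC, Finset.sum_comm]
    refine Finset.sum_le_sum fun j _ => ?_
    rw [← Finset.mul_sum]
    refine mul_le_mul_of_nonneg_left ?_ (h.nonneg j)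
    rw [← Finset.sum_image (f := c) (hφi j)]
    refine Finset.sum_le_sum_of_subset_of_nonneg ?_ fun e he _ => hc e ((h.spanning j).1 e he)
    intro e he
    obtain ⟨U, hU, rfl⟩ := Finset.mem_image.1 he
    exact (Finset.mem_inter.1 (hφm j U hU)).2
  have hjoin : ∀ i, cost c (M i) ≤ 1 / 5 * ∑ e ∈ J i, c e + 2 / 5 * lpCost G c x +
      ∑ U ∈ 𝓝, (if Even (cut G U ∩ J i).card then 1 else 0) *
        (2 / 5 * (3 / 2 - cutValue G x U) * C U) := by
    intro i
    have hy := (hM i).cost_le hG hc (sum_demand_wrongDegree_univ hT (h.spanning i).1)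
      (y := joinVector G x 𝓝 f (J i)) (fun e he => ?_)
      (fun S hS => one_le_sum_cut_joinVector hT hx (h.spanning i) h𝓝 hf0 hf1 hS)
    · rw [sum_mul_joinVector, Finset.inter_eq_right.2 (hJE i)] at hy
      refine hy.trans (le_of_eq ?_)
      congr 1
      exact Finset.sum_congr rfl fun U hU => by rw [hCsum U hU]
    · have h1 := hx.nonneg e he
      refine add_nonneg (add_nonneg (by split_ifs <;> norm_num) (by linarith))
        (Finset.sum_nonneg fun U hU => ?_)
      have h2 := ((h𝓝 U).1 hU).1.2
      exact mul_nonneg (by split_ifs <;> norm_num) (mul_nonneg (by linarith) (hf0 U e))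
  -- The number of tree edges in the cut, minus one, is never negative and is at least 1 when the
  -- number is even; its mean is `cutValue G x U - 1`.
  have hprob : ∀ U ∈ 𝓝, ∑ i, lam i * (if Even (cut G U ∩ J i).card then (1 : ℝ) else 0) ≤
      cutValue G x U - 1 := by
    intro U hU
    obtain ⟨hnar, hr⟩ := (h𝓝 U).1 hU
    have hne : U.Nonempty := by
      by_contra hn
      rw [Finset.not_nonempty_iff_eq_empty] at hn
      have := hnar.1
      simp [hn] at this
    have hval : cutValue G x U - 1 = ∑ i, (lam i * (cut G U ∩ J i).card - lam i) := by
      rw [Finset.sum_sub_distrib, h.sum_eq_one, h.cutValue_eq]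
    rw [hval]
    refine Finset.sum_le_sum fun i _ => ?_
    have h1 := (h.spanning i).one_le_card_cut hne fun hn => hr (by simp [hn])
    have h2 : (if Even (cut G U ∩ J i).card then (1 : ℝ) else 0) ≤ (cut G U ∩ J i).card - 1 := by
      split_ifs with he
      · have : 2 ≤ (cut G U ∩ J i).card := by
          rcases he with ⟨s, hs⟩
          omega
        have : (2 : ℝ) ≤ (cut G U ∩ J i).card := by exact_mod_cast this
        linarith
      · have : (1 : ℝ) ≤ (cut G U ∩ J i).card := by exact_mod_cast h1
        linarith
    have := mul_le_mul_of_nonneg_left h2 (h.nonneg i)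
    linarith
  have hcorr : ∑ i, lam i * ∑ U ∈ 𝓝, (if Even (cut G U ∩ J i).card then 1 else 0) *
      (2 / 5 * (3 / 2 - cutValue G x U) * C U) ≤ ∑ U ∈ 𝓝, 1 / 40 * C U := by
    have hswap : ∑ i, lam i * ∑ U ∈ 𝓝, (if Even (cut G U ∩ J i).card then 1 else 0) *
        (2 / 5 * (3 / 2 - cutValue G x U) * C U) =
        ∑ U ∈ 𝓝, (∑ i, lam i * (if Even (cut G U ∩ J i).card then (1 : ℝ) else 0)) *
          (2 / 5 * (3 / 2 - cutValue G x U) * C U) := by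
      simp_rw [Finset.mul_sum, Finset.sum_mul]
      rw [Finset.sum_comm]
      exact Finset.sum_congr rfl fun U _ => Finset.sum_congr rfl fun i _ => by ring
    rw [hswap]
    refine Finset.sum_le_sum fun U hU => ?_
    have h1 := ((h𝓝 U).1 hU).1.2
    have h2 := hC0 U hU
    have h3 := hprob U hU
    refine (mul_le_mul_of_nonneg_right h3 (mul_nonneg (by linarith) h2)).trans ?_
    rw [← mul_assoc]
    refine mul_le_mul_of_nonneg_right ?_ h2
    -- The product `(t - 1) * (3/2 - t)` has its maximum `1/16` at `t = 5/4`, and `2/5 * 1/16 =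
    -- 1/40`.
    nlinarith [sq_nonneg (cutValue G x U - 5 / 4)]
  calc ∑ i, lam i * cost c (M i)
      ≤ ∑ i, lam i * (1 / 5 * ∑ e ∈ J i, c e + 2 / 5 * lpCost G c x +
        ∑ U ∈ 𝓝, (if Even (cut G U ∩ J i).card then 1 else 0) *
          (2 / 5 * (3 / 2 - cutValue G x U) * C U)) :=
        Finset.sum_le_sum fun i _ => mul_le_mul_of_nonneg_left (hjoin i) (h.nonneg i)
    _ = 1 / 5 * ∑ i, lam i * ∑ e ∈ J i, c e + (∑ i, lam i) * (2 / 5 * lpCost G c x) +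
        ∑ i, lam i * ∑ U ∈ 𝓝, (if Even (cut G U ∩ J i).card then 1 else 0) *
          (2 / 5 * (3 / 2 - cutValue G x U) * C U) := by
        simp only [mul_add, Finset.sum_add_distrib]
        congr 1
        congr 1
        · rw [Finset.mul_sum]
          exact Finset.sum_congr rfl fun i _ => by ring
        · rw [Finset.sum_mul]
    _ ≤ 1 / 5 * lpCost G c x + 1 * (2 / 5 * lpCost G c x) + ∑ U ∈ 𝓝, 1 / 40 * C U := by
        rw [hcost, h.sum_eq_one]
        gcongr
    _ ≤ 5 / 8 * lpCost G c x := by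
        rw [← Finset.mul_sum]
        linarith

/-! ### Runs of the algorithm -/

lemma cost_solution (c : Sym2 V → ℝ) (J : Finset (Sym2 V)) (M : Multiset (Sym2 V)) :
    cost c (solution J M) = ∑ e ∈ J, c e + cost c M := by
  simp only [cost, solution, Multiset.map_add, Multiset.sum_add]
  rfl

lemma IsTreeDecomposition.sum_cost_tree {G : SimpleGraph V} [DecidableRel G.Adj]
    {c x : Sym2 V → ℝ} {k : ℕ} {J : Fin k → Finset (Sym2 V)} {lam : Fin k → ℝ}
    (h : IsTreeDecomposition G x J lam) : ∑ i, lam i * ∑ e ∈ J i, c e = lpCost G c x := by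
  have hx : lpCost G c x =
      ∑ e ∈ G.edgeFinset, ∑ i, c e * (lam i * if e ∈ J i then 1 else 0) :=
    Finset.sum_congr rfl fun e he => by
      rw [h.combination e (SimpleGraph.mem_edgeFinset.1 he), Finset.mul_sum]
  rw [hx, Finset.sum_comm]
  refine Finset.sum_congr rfl fun i _ => ?_
  have hJE : J i ⊆ G.edgeFinset := fun e he =>
    SimpleGraph.mem_edgeFinset.2 ((h.spanning i).1 e he)
  rw [Finset.mul_sum, ← Finset.inter_eq_right.2 hJE, ← Finset.sum_ite_mem]
  refine Finset.sum_congr rfl fun e he => ?_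
  simp only [Finset.mem_inter, he, true_and]
  split_ifs <;> ring

/-- The expected cost of the output of the randomized algorithm. -/
theorem IsRun.sum_cost_le {G : SimpleGraph V} [DecidableRel G.Adj] (hG : G.Connected)
    {c : Sym2 V → ℝ} (hc : ∀ e ∈ G.edgeSet, 0 ≤ c e) {T : Finset V} (hT : Even T.card)
    {x : Sym2 V → ℝ} {k : ℕ} {J : Fin k → Finset (Sym2 V)} {lam : Fin k → ℝ}
    {M : Fin k → Multiset (Sym2 V)} (h : IsRun G c T x J lam M) :
    ∑ i, lam i * cost c (solution (J i) (M i)) ≤ 13 / 8 * lpCost G c x := by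
  have h1 := h.decomposition.sum_cost_tree (c := c)
  have h2 := h.decomposition.sum_cost_join_le hG hc hT h.optimal.1 h.joins h1
  simp only [cost_solution, mul_add, Finset.sum_add_distrib]
  linarith

/-- Every optimal solution can be completed to a run of the algorithm. -/
lemma IsOptimal.exists_isOutput {G : SimpleGraph V} [DecidableRel G.Adj] (hG : G.Connected)
    {c : Sym2 V → ℝ} (hc : ∀ e ∈ G.edgeSet, 0 ≤ c e) {T : Finset V} (hT : Even T.card)
    {x : Sym2 V → ℝ} (hx : IsOptimal G c T x) : ∃ F, IsOutput G c T F := by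
  obtain ⟨k, J, lam, -, hd⟩ := hx.1.exists_decomposition hG
  choose M hM using fun i => exists_isMinCostJoin hG hc
    (sum_demand_wrongDegree_univ hT (hd.spanning i).1)
  have hne : (Finset.univ : Finset (Fin k)).Nonempty := by
    by_contra hn
    rw [Finset.not_nonempty_iff_eq_empty] at hn
    have := hd.sum_eq_one
    simp [hn] at this
  obtain ⟨i, -, hi⟩ := Finset.exists_min_image Finset.univ
    (fun i => cost c (solution (J i) (M i))) hne
  exact ⟨_, x, k, J, lam, M, ⟨hx, hd, hM⟩, i, rfl, fun j => hi j (Finset.mem_univ _)⟩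

end ConnectedTJoin

theorem mainTheorem1 {V : Type*} [Fintype V] [DecidableEq V]
    (G : SimpleGraph V) [DecidableRel G.Adj] (hG : G.Connected)
    (c : Sym2 V → ℝ) (hc : ∀ e ∈ G.edgeSet, 0 ≤ c e)
    (T : Finset V) (hT_even : Even T.card) (hT : 4 ≤ T.card) :
    -- the linear program is feasible on complete graphs, and solvable whenever it is feasible
    (G = ⊤ → ∃ x, ConnectedTJoin.IsFeasible G T x) ∧
    ((∃ x, ConnectedTJoin.IsFeasible G T x) → ∃ x, ConnectedTJoin.IsOptimal G c T x) ∧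
    -- the later steps of the algorithm can be carried out, whatever was chosen before
    (∀ x, ConnectedTJoin.IsOptimal G c T x →
      ∃ (k : ℕ) (J : Fin k → Finset (Sym2 V)) (lam : Fin k → ℝ),
        k ≤ G.edgeFinset.card + 1 ∧ ConnectedTJoin.IsTreeDecomposition G x J lam) ∧
    (∀ J, ConnectedTJoin.IsSpanningTree G J →
      ∃ M, ConnectedTJoin.IsMinCostJoin G c (ConnectedTJoin.wrongDegree T J) M) ∧
    -- randomized algorithm: always a connected `T`-join, of expected cost at most `13/8 * OPT`
    (∀ (x : Sym2 V → ℝ) (k : ℕ) (J : Fin k → Finset (Sym2 V)) (lam : Fin k → ℝ)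
      (M : Fin k → Multiset (Sym2 V)), ConnectedTJoin.IsRun G c T x J lam M →
        (∀ i, ConnectedTJoin.IsConnectedJoin G T (ConnectedTJoin.solution (J i) (M i))) ∧
        ∑ i, lam i * ConnectedTJoin.cost c (ConnectedTJoin.solution (J i) (M i)) ≤
          13 / 8 * ConnectedTJoin.lpCost G c x) ∧
    -- deterministic algorithm: an output exists, and every output is a connected `T`-join
    -- of cost at most `13/8 * OPT`
    ((∃ x, ConnectedTJoin.IsFeasible G T x) → ∃ F, ConnectedTJoin.IsOutput G c T F) ∧
    (∀ F, ConnectedTJoin.IsOutput G c T F →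
      ConnectedTJoin.IsConnectedJoin G T F ∧
      ∀ x, ConnectedTJoin.IsOptimal G c T x →
        ConnectedTJoin.cost c F ≤ 13 / 8 * ConnectedTJoin.lpCost G c x) := by
  open ConnectedTJoin in
  refine ⟨fun h => exists_isFeasible_top h hT_even (by omega), exists_isOptimal c,
    fun x hx => hx.1.exists_decomposition hG,
    fun J hJ => exists_isMinCostJoin hG hc (sum_demand_wrongDegree_univ hT_even hJ.1),
    fun x k J lam M h => ⟨fun i => isConnectedJoin_solution (h.decomposition.spanning i)
      (h.joins i).1, h.sum_cost_le hG hc hT_even⟩,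
    fun h => ?_, ?_⟩
  · obtain ⟨x, hx⟩ := exists_isOptimal c h
    exact hx.exists_isOutput hG hc hT_even
  · rintro F ⟨x, k, J, lam, M, h, i, rfl, hi⟩
    refine ⟨isConnectedJoin_solution (h.decomposition.spanning i) (h.joins i).1, fun x' hx' => ?_⟩
    have h1 := h.sum_cost_le hG hc hT_even
    have h2 := h.optimal.2 x' hx'.1
    -- The cheapest solution costs at most the average.
    have h3 : cost c (solution (J i) (M i)) ≤ ∑ j, lam j * cost c (solution (J j) (M j)) := by
      calc cost c (solution (J i) (M i)) = ∑ j, lam j * cost c (solution (J i) (M i)) := by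
            rw [← Finset.sum_mul, h.decomposition.sum_eq_one, one_mul]
        _ ≤ _ := Finset.sum_le_sum fun j _ =>
            mul_le_mul_of_nonneg_left (hi j) (h.decomposition.nonneg j)
    linarith
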